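/- **Setting.** An *infinite ideal hyperbolic polyhedron* $\mathcal P$ is the convex hull in $\mathbb H^3$ of an infinite countable set $S\subset\partial_\infty\mathbb H^3$ of isolated points (its ideal vertices) whose boundary is a connected, locally finite polyhedral surface with vertex set $S$. This means: every two-dimensional face, i.e. the polygon spanned by the points of $S$ on a supporting plane containing at least three of them, has finitely many ideal vertices; each point of $S$ lies on at least one and on only finitely many faces; each side of a face is also a side of another face; and any two faces are joined by a chain of faces in which consecutive ones share an edge. For an edge $e$ let $\Theta_{\mathcal P}(e)\in(0,\pi)$ be the interior dihedral angle of $\mathcal P$ along $e$. For a face $f$ let $\deg f$ be its number of boundary edges, and for an ideal vertex $v$ let $\deg v$ be the number of faces meeting at $v$. Put $$T_{\mathcal P}(f)=\sum_{e\in\partial f}\Theta_{\mathcal P}(e),\qquad \theta_{\mathcal P}(f)=\sum_{v\in\partial f}\frac{(\deg v-2)\pi}{\deg v}.$$ The dual $1$-skeleton $P_1^*$ is the graph whose vertices are the faces of $\mathcal P$, two being adjacent if they share an edge $e$; this dual edge carries the weight $\Theta_{\mathcal P}(e)$. A random infinite ideal hyperbolic polyhedron $\mathcal P$ rooted at a face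 $f_\rho$ is called *unimodular* if the isomorphism class of the rooted weighted graph $(P_1^*,f_\rho,\Theta_{\mathcal P})$ is a random variable (for the Borel structure of the local topology on isomorphism classes of connected, locally finite, rooted simple graphs with edge weights in $(0,\pi)$), and for every Borel function $F\ge 0$ (with values in $[0,\infty]$) of isomorphism classes of such weighted graphs with an ordered pair of distinguished vertices, $$\mathbb E\Big[\sum_{g}F(P_1^*,\Theta_{\mathcal P};f_\rho,g)\Big]=\mathbb E\Big[\sum_{g}F(P_1^*,\Theta_{\mathcal P};g,f_\rho)\Big],$$ where $g$ ranges over the faces of $\mathcal P$. **Theorem.** Let $\mathcal P$ be a unimodular random infinite ideal hyperbolic polyhedron with root face $f_\rho$. Then $$\mathbb E\big[T_{\mathcal P}(f_\rho)\big]=\mathbb E\big[\theta_{\mathcal P}(f_\rho)\big]\quad\text{in }[0,\infty].$$ If moreover $\mathbb E[\deg f_\rho]<\infty$, then both expectations are finite. -/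

import Mathlib

open MeasureTheory
open scoped ENNReal

/-- Euclidean three-space. Its open unit ball is the Klein (projective) model of hyperbolic
three-space `ℍ³`: geodesics are chords, hyperbolic planes are the sections of the ball by affine
planes, hyperbolic convex hulls are Euclidean convex hulls, and the unit sphere is the sphere at
infinity. -/
abbrev E3 : Type := EuclideanSpace ℝ (Fin 3)

/-- A two-dimensional face of the convex hull of a set `S` of points of the unit sphere, given by
its supporting plane `{x | ⟪normal, x⟫ = offset}` with outward unit normal: the hull lies on one
side, and at least three points of `S` lie on the plane (three distinct points of a sphere are never
collinear, so these points span the plane). -/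
@[ext]
structure IdealFace (S : Set E3) where
  normal : E3
  offset : ℝ
  norm_normal : ‖normal‖ = 1
  supports : ∀ x ∈ convexHull ℝ S, inner ℝ normal x ≤ offset
  three_le : 3 ≤ {x ∈ S | inner ℝ normal x = offset}.encard

namespace IdealFace

variable {S : Set E3}

/-- The ideal vertices of a face; the face is the ideal polygon that they span. -/
def verts (f : IdealFace S) : Set E3 := {x ∈ S | inner ℝ f.normal x = f.offset}

/-- `x` and `y` are the endpoints of a side of the convex polygon `f`: some line of its plane
supports the polygon and meets its vertex set exactly in `x ≠ y`. -/
def IsSide (f : IdealFace S) (x y : E3) : Prop :=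
  x ≠ y ∧ ∃ (m : E3) (d : ℝ), (∀ z ∈ f.verts, inner ℝ m z ≤ d) ∧
    {z ∈ f.verts | inner ℝ m z = d} = {x, y}

/-- The dual `1`-skeleton: two faces are adjacent when they are different and share an edge, that
is, have exactly two ideal vertices in common (the planes of two different faces meet at most in a
line, so two faces share at most one edge). -/
def dualGraph (S : Set E3) : SimpleGraph (IdealFace S) where
  Adj f g := f ≠ g ∧ (f.verts ∩ g.verts).encard = 2
  symm := ⟨fun f g h => ⟨h.1.symm, by rw [Set.inter_comm]; exact h.2⟩⟩
  loopless := ⟨fun _ h => h.1 rfl⟩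

/-- The hyperbolic dihedral angle, measured inside the polyhedron, between the planes of two faces.
The plane with outward unit normal `n` and offset `c` has the spacelike normal `(n, c)` in Minkowski
space, of squared length `1 - c ^ 2`; the angle between the outward normals of two intersecting
planes is the `arccos` of their normalized Minkowski product, and the inner dihedral angle is its
supplement. -/
noncomputable def dihedral (f g : IdealFace S) : ℝ :=
  Real.arccos (-(inner ℝ f.normal g.normal - f.offset * g.offset) /
    (Real.sqrt (1 - f.offset ^ 2) * Real.sqrt (1 - g.offset ^ 2)))

theorem dihedral_comm (f g : IdealFace S) : f.dihedral g = g.dihedral f := by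
  unfold dihedral
  rw [real_inner_comm, mul_comm f.offset, mul_comm (Real.sqrt (1 - f.offset ^ 2))]

end IdealFace

/-- An infinite ideal polyhedron of `ℍ³`: the convex hull of an infinite countable set of isolated
points of the sphere at infinity whose boundary is a connected, locally finite polyhedral surface
with this set of ideal vertices: faces are finite polygons, every ideal vertex lies on at least one
and only finitely many faces, every side of a face is also a side of another face, and any two faces
are joined by a chain of adjacent faces. -/
structure InfiniteIdealPolyhedron where
  vertices : Set E3
  subset_sphere : vertices ⊆ Metric.sphere 0 1
  countable : vertices.Countable
  infinite : vertices.Infinite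
  isolated : ∀ x ∈ vertices, ∃ ε > 0, ∀ y ∈ vertices, dist x y < ε → y = x
  finite_verts : ∀ f : IdealFace vertices, f.verts.Finite
  exists_face : ∀ x ∈ vertices, ∃ f : IdealFace vertices, x ∈ f.verts
  finite_star : ∀ x ∈ vertices, {f : IdealFace vertices | x ∈ f.verts}.Finite
  exists_across : ∀ (f : IdealFace vertices) (x y : E3), f.IsSide x y →
    ∃ g : IdealFace vertices, g ≠ f ∧ x ∈ g.verts ∧ y ∈ g.verts
  connected : (IdealFace.dualGraph vertices).Connected

/-- A connected, locally finite simple graph whose edges carry angles in `(0, π)`. The value of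
`angle` at a pair of vertices that are not adjacent is irrelevant. -/
structure AngledGraph where
  V : Type
  graph : SimpleGraph V
  connected : graph.Connected
  finite_neighborSet : ∀ v, (graph.neighborSet v).Finite
  angle : V → V → ℝ
  angle_comm : ∀ u v, angle u v = angle v u
  angle_mem : ∀ u v, graph.Adj u v → angle u v ∈ Set.Ioo 0 Real.pi

namespace AngledGraph

/-- The ball of radius `r` around `o` in the graph distance. -/
def ball (X : AngledGraph) (o : X.V) (r : ℕ) : Set X.V := {v | X.graph.dist o v ≤ r}

theorem self_mem_ball (X : AngledGraph) (o : X.V) (r : ℕ) : o ∈ X.ball o r := by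
  simp [ball]

/-- Isomorphisms between the (induced) balls of radius `r` around `o` and `o'`. -/
abbrev BallIso (X Y : AngledGraph) (o : X.V) (o' : Y.V) (r : ℕ) :=
  X.graph.induce (X.ball o r) ≃g Y.graph.induce (Y.ball o' r)

/-- The isomorphism of balls respects the centers and changes all edge angles by less than `ε`. -/
def BallIso.Close {X Y : AngledGraph} {o : X.V} {o' : Y.V} {r : ℕ} (φ : BallIso X Y o o' r)
    (ε : ℝ) : Prop :=
  (φ ⟨o, X.self_mem_ball o r⟩ : Y.V) = o' ∧
    ∀ u v : X.ball o r, X.graph.Adj u v → |X.angle u v - Y.angle (φ u) (φ v)| < ε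

/-- The graph isomorphism preserves the angles of all edges. -/
def PreservesAngles {X Y : AngledGraph} (φ : X.graph ≃g Y.graph) : Prop :=
  ∀ u v, X.graph.Adj u v → Y.angle (φ u) (φ v) = X.angle u v

theorem PreservesAngles.refl (X : AngledGraph) :
    PreservesAngles (X := X) (Y := X) (SimpleGraph.Iso.refl) := fun _ _ _ => rfl

theorem PreservesAngles.symm {X Y : AngledGraph} {φ : X.graph ≃g Y.graph}
    (h : PreservesAngles φ) : PreservesAngles φ.symm := fun u v huv => by
  have := h (φ.symm u) (φ.symm v) (φ.symm.map_adj_iff.2 huv)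
  simpa using this.symm

theorem PreservesAngles.trans {X Y Z : AngledGraph} {φ : X.graph ≃g Y.graph}
    {ψ : Y.graph ≃g Z.graph} (h : PreservesAngles φ) (k : PreservesAngles ψ) :
    PreservesAngles (X := X) (Y := Z) (φ.trans ψ) := fun u v huv => by
  have := k (φ u) (φ v) (φ.map_adj_iff.2 huv)
  rw [h u v huv] at this
  exact this

end AngledGraph

/-- An angled graph with a root. -/
structure RootedAngledGraph extends AngledGraph where
  root : V

namespace RootedAngledGraph

/-- Isomorphism of rooted angled graphs. -/
instance isoSetoid : Setoid RootedAngledGraph where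
  r X Y := ∃ φ : X.graph ≃g Y.graph, AngledGraph.PreservesAngles φ ∧ φ X.root = Y.root
  iseqv :=
    { refl := fun X => ⟨SimpleGraph.Iso.refl, .refl _, rfl⟩
      symm := fun ⟨φ, h, e⟩ => ⟨φ.symm, h.symm, by rw [← e]; simp⟩
      trans := fun ⟨φ, h, e⟩ ⟨ψ, k, e'⟩ => ⟨φ.trans ψ, h.trans k, by
        rw [← e', ← e]; rfl⟩ }

/-- The rooted angled graphs whose `r`-ball around the root agrees with that of `X` up to an
isomorphism that changes the angles by less than `ε`. -/
def near (X : RootedAngledGraph) (r : ℕ) (ε : ℝ) : Set RootedAngledGraph :=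
  {Y | ∃ φ : AngledGraph.BallIso X.toAngledGraph Y.toAngledGraph X.root Y.root r, φ.Close ε}

/-- The local (Benjamini-Schramm) topology. -/
instance : TopologicalSpace RootedAngledGraph :=
  TopologicalSpace.generateFrom {U | ∃ (X : RootedAngledGraph) (r : ℕ) (ε : ℝ), U = X.near r ε}

/-- The space of isomorphism classes of rooted angled graphs, with the local topology. -/
abbrev Class : Type 1 := Quotient isoSetoid

instance : MeasurableSpace Class := borel Class

end RootedAngledGraph

/-- An angled graph with an ordered pair of distinguished vertices. -/
structure BirootedAngledGraph extends AngledGraph where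
  root : V
  mark : V

namespace BirootedAngledGraph

/-- Isomorphism of doubly rooted angled graphs. -/
instance isoSetoid : Setoid BirootedAngledGraph where
  r X Y := ∃ φ : X.graph ≃g Y.graph,
    AngledGraph.PreservesAngles φ ∧ φ X.root = Y.root ∧ φ X.mark = Y.mark
  iseqv :=
    { refl := fun X => ⟨SimpleGraph.Iso.refl, .refl _, rfl, rfl⟩
      symm := fun ⟨φ, h, e, d⟩ => ⟨φ.symm, h.symm, by rw [← e]; simp, by rw [← d]; simp⟩
      trans := fun ⟨φ, h, e, d⟩ ⟨ψ, k, e', d'⟩ => ⟨φ.trans ψ, h.trans k, by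
        rw [← e', ← e]; rfl, by rw [← d', ← d]; rfl⟩ }

/-- The doubly rooted angled graphs whose `r`-ball around the first root contains the second root
and agrees with that of `X`, including the second root, up to an isomorphism that changes the angles
by less than `ε`. -/
def near (X : BirootedAngledGraph) (r : ℕ) (ε : ℝ) : Set BirootedAngledGraph :=
  {Y | ∃ φ : AngledGraph.BallIso X.toAngledGraph Y.toAngledGraph X.root Y.root r,
    φ.Close ε ∧ ∃ h : X.mark ∈ X.ball X.root r, (φ ⟨X.mark, h⟩ : Y.V) = Y.mark}

/-- The local topology. -/
instance : TopologicalSpace BirootedAngledGraph :=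
  TopologicalSpace.generateFrom {U | ∃ (X : BirootedAngledGraph) (r : ℕ) (ε : ℝ), U = X.near r ε}

/-- The space of isomorphism classes of doubly rooted angled graphs, with the local topology. -/
abbrev Class : Type 1 := Quotient isoSetoid

instance : MeasurableSpace Class := borel Class

end BirootedAngledGraph

/-- The class of the angled graph `X` with the ordered pair `(u, v)` of distinguished vertices. -/
def AngledGraph.pair (X : AngledGraph) (u v : X.V) : BirootedAngledGraph.Class :=
  Quotient.mk _ { X with root := u, mark := v }

/-- A family `X` of rooted angled graphs over a probability space is a unimodular random rooted
angled graph: its isomorphism class is a random variable, and it satisfies the mass-transport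
principle for all Borel transports `F : 𝒳_•• → [0, ∞]`. -/
structure IsUnimodular {Ω : Type*} [MeasurableSpace Ω] (μ : Measure Ω)
    (X : Ω → RootedAngledGraph) : Prop where
  measurable : Measurable fun ω => (Quotient.mk _ (X ω) : RootedAngledGraph.Class)
  mass_transport : ∀ F : BirootedAngledGraph.Class → ℝ≥0∞, Measurable F →
    ∫⁻ ω, ∑' v : (X ω).V, F ((X ω).pair (X ω).root v) ∂μ =
      ∫⁻ ω, ∑' v : (X ω).V, F ((X ω).pair v (X ω).root) ∂μ

namespace InfiniteIdealPolyhedron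

variable (P : InfiniteIdealPolyhedron)

/-- The faces of the polyhedron. -/
abbrev Face : Type := IdealFace P.vertices

/-- The number of faces meeting at an ideal vertex. -/
noncomputable def vertexDegree (v : E3) : ℕ := {f : P.Face | v ∈ f.verts}.ncard

/-- The number of boundary edges of a face; each of them is the common edge of `f` and exactly one
adjacent face. -/
noncomputable def faceDegree (f : P.Face) : ℕ :=
  ((IdealFace.dualGraph P.vertices).neighborSet f).ncard

/-- The character `T_P(f)`: the sum of the dihedral angles over the boundary edges of `f`, each
edge being the common edge of `f` and exactly one adjacent face. -/
noncomputable def character (f : P.Face) : ℝ :=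
  ∑ᶠ g ∈ (IdealFace.dualGraph P.vertices).neighborSet f, f.dihedral g

/-- The combinatorial angle `θ_P(f)`: the sum of `(deg v - 2) π / deg v` over the ideal vertices
`v` of `f`. -/
noncomputable def combinatorialAngle (f : P.Face) : ℝ :=
  ∑ᶠ v ∈ f.verts, ((P.vertexDegree v : ℝ) - 2) * Real.pi / (P.vertexDegree v : ℝ)

theorem finite_neighborSet (f : P.Face) :
    ((IdealFace.dualGraph P.vertices).neighborSet f).Finite := by
  refine ((P.finite_verts f).biUnion fun x hx => P.finite_star x hx.1).subset ?_
  intro g hg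
  have h2 : (f.verts ∩ g.verts).encard = 2 := hg.2
  have hne : (f.verts ∩ g.verts).Nonempty := by
    rw [← Set.encard_ne_zero, h2]; norm_num
  obtain ⟨x, hxf, hxg⟩ := hne
  exact Set.mem_biUnion hxf hxg

theorem dihedral_mem (f g : P.Face) (h : (IdealFace.dualGraph P.vertices).Adj f g) :
    f.dihedral g ∈ Set.Ioo 0 Real.pi := by
  obtain ⟨hne, h2⟩ := h
  obtain ⟨v, w, hvw, hE⟩ := Set.encard_eq_two.1 h2
  have hv : v ∈ f.verts ∩ g.verts := by rw [hE]; simp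
  have hw : w ∈ f.verts ∩ g.verts := by rw [hE]; simp
  have hv1 : ‖v‖ = 1 := by simpa using P.subset_sphere hv.1.1
  have hw1 : ‖w‖ = 1 := by simpa using P.subset_sphere hw.1.1
  have hfv : inner ℝ f.normal v = f.offset := hv.1.2
  have hgv : inner ℝ g.normal v = g.offset := hv.2.2
  have hfw : inner ℝ f.normal w = f.offset := hw.1.2
  have hgw : inner ℝ g.normal w = g.offset := hw.2.2
  have hlt : inner ℝ v w < 1 := by
    have := inner_lt_norm_mul_iff_real (x := v) (y := w)
    rw [hv1, hw1, one_smul, one_smul, one_mul] at this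
    exact this.2 hvw
  set a := f.normal - f.offset • v with ha
  set b := g.normal - g.offset • v with hb
  have hvv : inner ℝ v v = (1 : ℝ) := by rw [real_inner_self_eq_norm_sq, hv1]; norm_num
  have hff : inner ℝ f.normal f.normal = (1 : ℝ) := by
    rw [real_inner_self_eq_norm_sq, f.norm_normal]; norm_num
  have hgg : inner ℝ g.normal g.normal = (1 : ℝ) := by
    rw [real_inner_self_eq_norm_sq, g.norm_normal]; norm_num
  have hvf : inner ℝ v f.normal = f.offset := by rw [real_inner_comm]; exact hfv
  have hvg : inner ℝ v g.normal = g.offset := by rw [real_inner_comm]; exact hgv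
  have hab : inner ℝ a b = inner ℝ f.normal g.normal - f.offset * g.offset := by
    simp only [ha, hb, inner_sub_left, inner_sub_right, real_inner_smul_left,
      real_inner_smul_right, hvv, hvg, hfv]
    ring
  have haa : ‖a‖ = Real.sqrt (1 - f.offset ^ 2) := by
    rw [norm_eq_sqrt_real_inner]
    congr 1
    simp only [ha, inner_sub_left, inner_sub_right, real_inner_smul_left,
      real_inner_smul_right, hvv, hvf, hfv, hff]
    ring
  have hbb : ‖b‖ = Real.sqrt (1 - g.offset ^ 2) := by
    rw [norm_eq_sqrt_real_inner]
    congr 1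
    simp only [hb, inner_sub_left, inner_sub_right, real_inner_smul_left,
      real_inner_smul_right, hvv, hvg, hgv, hgg]
    ring
  have haw : inner ℝ a w = f.offset * (1 - inner ℝ v w) := by
    simp only [ha, inner_sub_left, real_inner_smul_left, hfw]; ring
  have hbw : inner ℝ b w = g.offset * (1 - inner ℝ v w) := by
    simp only [hb, inner_sub_left, real_inner_smul_left, hgw]; ring
  have hkey : ∀ (n : E3) (c : ℝ), ‖n‖ = 1 → n - c • v = 0 →
      inner ℝ (n - c • v) w = c * (1 - inner ℝ v w) → False := by
    intro n c hn h0 h1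
    rw [h0, inner_zero_left] at h1
    rcases mul_eq_zero.1 h1.symm with h | h
    · rw [h, zero_smul, sub_zero] at h0
      rw [h0, norm_zero] at hn
      norm_num at hn
    · linarith
  have ha0 : a ≠ 0 := fun h => hkey _ _ f.norm_normal h haw
  have hb0 : b ≠ 0 := fun h => hkey _ _ g.norm_normal h hbw
  have hnot : ∀ t : ℝ, b ≠ t • a := by
    intro t ht
    have hc : g.offset = t * f.offset := by
      have h3 : inner ℝ b w = t * inner ℝ a w := by rw [ht, real_inner_smul_left]
      rw [haw, hbw] at h3
      have h4 : (g.offset - t * f.offset) * (1 - inner ℝ v w) = 0 := by linarith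
      rcases mul_eq_zero.1 h4 with h5 | h5 <;> linarith
    have hn : g.normal = t • f.normal := by
      have h3 : g.normal = b + g.offset • v := by rw [hb]; abel
      rw [h3, ht, ha, hc, smul_sub, smul_smul]; abel
    have ht1 : |t| = 1 := by
      have := congrArg norm hn
      rw [norm_smul, f.norm_normal, g.norm_normal, mul_one] at this
      exact this.symm
    rcases eq_or_eq_neg_of_abs_eq ht1 with rfl | rfl
    · exact hne (IdealFace.ext (by simpa using hn.symm) (by simpa using hc.symm))
    · refine P.infinite ((P.finite_verts f).subset fun x hx => ⟨hx, ?_⟩)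
      have h3 := f.supports x (subset_convexHull ℝ _ hx)
      have h4 := g.supports x (subset_convexHull ℝ _ hx)
      rw [hn, hc, real_inner_smul_left] at h4
      linarith
  have hpos : 0 < ‖a‖ * ‖b‖ := mul_pos (norm_pos_iff.2 ha0) (norm_pos_iff.2 hb0)
  have habs : |inner ℝ a b| < ‖a‖ * ‖b‖ := by
    refine lt_of_le_of_ne (abs_real_inner_le_norm a b) fun h => ?_
    have h1 : |inner ℝ a b / (‖a‖ * ‖b‖)| = 1 := by
      rw [abs_div, abs_of_pos hpos, h, div_self hpos.ne']
    obtain ⟨-, t, -, ht⟩ := (abs_real_inner_div_norm_mul_norm_eq_one_iff a b).1 h1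
    exact hnot t ht
  have hd : f.dihedral g = Real.arccos (-(inner ℝ a b / (‖a‖ * ‖b‖))) := by
    unfold IdealFace.dihedral
    rw [← hab, ← haa, ← hbb, neg_div]
  have h1 : |inner ℝ a b / (‖a‖ * ‖b‖)| < 1 := by
    rw [abs_div, abs_of_pos hpos, div_lt_one hpos]; exact habs
  rw [abs_lt] at h1
  rw [hd]
  refine ⟨Real.arccos_pos.2 (by linarith [h1.1]), lt_of_le_of_ne (Real.arccos_le_pi _) ?_⟩
  intro h
  rw [Real.arccos_eq_pi] at h
  linarith [h1.2]

/-- The dual `1`-skeleton of the polyhedron with its dihedral angles. -/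
noncomputable def dual : AngledGraph where
  V := P.Face
  graph := IdealFace.dualGraph P.vertices
  connected := P.connected
  finite_neighborSet := P.finite_neighborSet
  angle := IdealFace.dihedral
  angle_comm := IdealFace.dihedral_comm
  angle_mem := P.dihedral_mem

/-- The dual `1`-skeleton with its dihedral angles, rooted at a face of the polyhedron. -/
noncomputable def rootedDual (f : P.Face) : RootedAngledGraph :=
  { P.dual with root := f }

end InfiniteIdealPolyhedron

/-! The proof is a mass transport on the dual graph. Around an ideal vertex of degree `k` the faces
form a cycle, and the link of the vertex is a Euclidean convex `k`-gon, so the dihedral angles along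
the cycle add up to `(k - 2)π`. For each oriented cycle of this kind, every face on it sends the
angle at its next edge, divided by `2k`, to each of the `k` faces of the cycle. A face thus sends
half of one edge angle per oriented cycle. Each of its edges starts two cycles, one for each end, so
it sends `T(f)` in total (`tsum_transport_out_eq`). It receives `(k - 2)π / (2k)` per oriented
cycle, and each of its vertices carries two orientations, so it receives `θ(f)`
(`tsum_transport_in_eq`). The mass-transport principle equates the expectations, and `T(f) ≤ π deg
f` gives finiteness.

The transport may depend only on the weighted graph, so the vertex cycles must be recognized from
the angles. They are exactly the simple cycles whose exterior angles add up to `2π`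
(`exists_equiv_vertexCycles`). One direction is the turning of a convex polygon
(`existsUnique_cycleSeq_at`). For the other (`exists_common_vertex`), join the outward unit normals
of the faces along the cycle by geodesic arcs in de Sitter space. This closed curve has length `2π`
and satisfies `N'' + N = ∑ J_i δ_{t_i}`, where the jump `J_i` is the sum of the outward normals of
two sides of a face. It is future causal, and lightlike only in the direction of a common ideal
vertex of the sides (`edgeNormal_add`). Closing up forces `∑_{j<i} (π - (t_i - t_j)) sin(t_i - t_j)
⟨J_i, J_j⟩ = 0`, in which no term is positive (`jump_orthogonal`). Hence consecutive jumps are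
orthogonal, so they are parallel lightlike vectors, and all faces of the cycle share one ideal
vertex.

The transport is Borel because the condition on the angle sum is a limit of continuous weights, and
sums of continuous weights over cycles through the root are continuous in the local topology. -/

theorem Finset.sum_range_sum_range_symm (n : ℕ) (f : ℕ → ℕ → ℝ) (hs : ∀ i j, f i j = f j i)
    (h0 : ∀ i, f i i = 0) :
    ∑ i ∈ range n, ∑ j ∈ range n, f i j = 2 * ∑ i ∈ range n, ∑ j ∈ range i, f i j := by
  induction n with
  | zero => simp
  | succ n ih =>
    have h1 : ∑ i ∈ range n, f i n = ∑ j ∈ range n, f n j := sum_congr rfl fun i _ => hs i n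
    simp only [sum_range_succ, sum_add_distrib]
    rw [ih, h1, h0]
    ring

/-! ### Closed piecewise trigonometric curves of length `2π`. -/

section Fenchel

variable {E : Type*} [AddCommGroup E] [Module ℝ E] {N T J : ℕ → E} {α : ℕ → ℝ}

/-- A piecewise trigonometric curve is determined by its initial data and its derivative jumps. -/
theorem piecewise_trig_eq {s : ℕ → ℝ} (hs0 : s 0 = 0) (hs : ∀ i, s (i + 1) = s i + α i)
    (hN : ∀ i, N (i + 1) = Real.cos (α i) • N i + Real.sin (α i) • T i)
    (hT : ∀ i, T (i + 1) = -Real.sin (α i) • N i + Real.cos (α i) • T i + J (i + 1)) (i : ℕ) :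
    N i = Real.cos (s i) • N 0 + Real.sin (s i) • T 0
      + ∑ j ∈ Finset.range i, Real.sin (s i - s (j + 1)) • J (j + 1) ∧
    T i = -Real.sin (s i) • N 0 + Real.cos (s i) • T 0
      + ∑ j ∈ Finset.range i, Real.cos (s i - s (j + 1)) • J (j + 1) := by
  induction i with
  | zero => simp [hs0]
  | succ i ih =>
    have e1 : ∀ j, Real.sin (s (i + 1) - s (j + 1)) • J (j + 1) =
        Real.cos (α i) • (Real.sin (s i - s (j + 1)) • J (j + 1)) +
        Real.sin (α i) • (Real.cos (s i - s (j + 1)) • J (j + 1)) := fun j => by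
      rw [hs, add_sub_right_comm, Real.sin_add]; module
    have e2 : ∀ j, Real.cos (s (i + 1) - s (j + 1)) • J (j + 1) =
        -Real.sin (α i) • (Real.sin (s i - s (j + 1)) • J (j + 1)) +
        Real.cos (α i) • (Real.cos (s i - s (j + 1)) • J (j + 1)) := fun j => by
      rw [hs, add_sub_right_comm, Real.cos_add]; module
    rw [hN, hT, Finset.sum_range_succ, Finset.sum_range_succ, sub_self, Real.sin_zero,
      Real.cos_zero, Finset.sum_congr rfl fun j _ => e1 j, Finset.sum_congr rfl fun j _ => e2 j,
      Finset.sum_add_distrib, Finset.sum_add_distrib, ← Finset.smul_sum, ← Finset.smul_sum,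
      ← Finset.smul_sum, ← Finset.smul_sum, hs, Real.cos_add, Real.sin_add]
    constructor
    · conv_lhs => rw [ih.1, ih.2]
      module
    · conv_lhs => rw [ih.1, ih.2]
      module

/-- If a closed piecewise trigonometric curve of total length `2π` is orthogonal to its derivative
jumps and these jumps have nonpositive mutual products, then consecutive jumps are orthogonal. -/
theorem jump_orthogonal (B : E →ₗ[ℝ] E →ₗ[ℝ] ℝ) (hB : ∀ x y, B x y = B y x) {n : ℕ}
    (hN : ∀ i, N (i + 1) = Real.cos (α i) • N i + Real.sin (α i) • T i)
    (hT : ∀ i, T (i + 1) = -Real.sin (α i) • N i + Real.cos (α i) • T i + J (i + 1))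
    (hNn : N n = N 0) (hTn : T n = T 0) (hα : ∀ i, α i ∈ Set.Ioo 0 Real.pi)
    (hsum : ∑ i ∈ Finset.range n, α i = 2 * Real.pi)
    (hNJ : ∀ i, B (N i) (J i) = 0) (hJJ : ∀ i j, B (J i) (J j) ≤ 0) (i : ℕ) (hi : i + 1 < n) :
    B (J (i + 2)) (J (i + 1)) = 0 := by
  set s : ℕ → ℝ := fun i => ∑ l ∈ Finset.range i, α l with hsdef
  have hs0 : s 0 = 0 := by simp [hsdef]
  have hss : ∀ i, s (i + 1) = s i + α i := fun i => Finset.sum_range_succ _ _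
  have hsum : s n = 2 * Real.pi := hsum
  have htrig := piecewise_trig_eq hs0 hss hN hT
  set t : ℕ → ℝ := fun i => s (i + 1) with ht
  have hmono : StrictMono t := strictMono_nat_of_lt_succ fun i => by
    simp only [ht]
    rw [hss (i + 1)]
    linarith [(hα (i + 1)).1]
  have ht0 : ∀ i, 0 < t i := fun i =>
    Finset.sum_pos (fun j _ => (hα j).1) (by simp)
  have htn : ∀ i < n, t i ≤ 2 * Real.pi := fun i hi => by
    rw [← hsum]
    exact Finset.sum_le_sum_of_subset_of_nonneg (Finset.range_subset_range.2 hi)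
      fun j _ _ => (hα j).1.le
  obtain ⟨h1, h2⟩ := htrig n
  rw [hsum, Real.cos_two_pi, Real.sin_two_pi, hNn] at h1
  rw [hsum, Real.cos_two_pi, Real.sin_two_pi, hTn] at h2
  have e1 : ∀ j, Real.sin (2 * Real.pi - t j) = -Real.sin (t j) := fun j => by
    rw [Real.sin_two_pi_sub]
  have e2 : ∀ j, Real.cos (2 * Real.pi - t j) = Real.cos (t j) := fun j => by
    rw [Real.cos_two_pi_sub]
  have hsin : ∑ j ∈ Finset.range n, Real.sin (t j) • J (j + 1) = 0 := by
    have : ∑ j ∈ Finset.range n, Real.sin (2 * Real.pi - t j) • J (j + 1) = 0 := by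
      simpa using h1
    simpa [e1] using this
  have hcos : ∑ j ∈ Finset.range n, Real.cos (t j) • J (j + 1) = 0 := by
    have : ∑ j ∈ Finset.range n, Real.cos (2 * Real.pi - t j) • J (j + 1) = 0 := by
      simpa using h2
    simpa [e2] using this
  set D : ℕ → ℕ → ℝ := fun i j => B (J (i + 1)) (J (j + 1)) with hD
  have hDs : ∀ i j, D i j = D j i := fun i j => hB _ _
  set a : ℕ → ℕ → ℝ := fun i j => Real.sin (t i - t j) * D i j with ha
  have has : ∀ i j, a i j = -a j i := fun i j => by
    simp only [ha]
    rw [← neg_sub (t j), Real.sin_neg, hDs i j]; ring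
  -- Pairing the explicit form of `N` at a jump with that jump gives 0. The sum over all jumps
  -- leaves only the initial data paired with the two closing relations.
  have hX : ∑ i ∈ Finset.range n, ∑ j ∈ Finset.range i, a i j = 0 := by
    have h3 : ∀ i, ∑ j ∈ Finset.range i, a i j =
        -(B (N 0) (Real.cos (t i) • J (i + 1))) - B (T 0) (Real.sin (t i) • J (i + 1)) := fun i => by
      have h4 := hNJ (i + 1)
      rw [(htrig (i + 1)).1, Finset.sum_range_succ, sub_self, Real.sin_zero,
        zero_smul, add_zero] at h4
      simp only [map_add, map_smul, LinearMap.add_apply, LinearMap.smul_apply, map_sum,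
        LinearMap.sum_apply, smul_eq_mul] at h4 ⊢
      have h5 : ∑ j ∈ Finset.range i, a i j = ∑ x ∈ Finset.range i,
          Real.sin (s (i + 1) - s (x + 1)) *
            (B (J (x + 1))) (J (i + 1)) :=
        Finset.sum_congr rfl fun j _ => by simp only [ha]; rw [hDs]
      rw [h5]
      linarith
    rw [Finset.sum_congr rfl fun i _ => h3 i, Finset.sum_sub_distrib, Finset.sum_neg_distrib,
      ← map_sum, ← map_sum, hsin, hcos]
    simp
  -- By the addition formula each full row sum of `a` is a combination of the closing relations, so
  -- any weights on the rows are allowed.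
  have hY : ∑ i ∈ Finset.range n, ∑ j ∈ Finset.range n, t i * a i j = 0 := by
    refine Finset.sum_eq_zero fun i _ => ?_
    have h3 : ∑ j ∈ Finset.range n, a i j = B (J (i + 1))
        (Real.sin (t i) • ∑ j ∈ Finset.range n, Real.cos (t j) • J (j + 1) -
          Real.cos (t i) • ∑ j ∈ Finset.range n, Real.sin (t j) • J (j + 1)) := by
      simp only [map_sub, map_smul, map_sum, smul_eq_mul, Finset.mul_sum,
        ← Finset.sum_sub_distrib, ha, hD]
      refine Finset.sum_congr rfl fun j _ => ?_
      rw [Real.sin_sub]; ring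
    rw [← Finset.mul_sum, h3, hsin, hcos]
    simp
  -- Antisymmetry of `a` makes `(t i - t j) * a i j` symmetric, so the triangle is half of the
  -- square.
  have hY' : ∑ i ∈ Finset.range n, ∑ j ∈ Finset.range i, (t i - t j) * a i j = 0 := by
    have h3 := Finset.sum_range_sum_range_symm n (fun i j => (t i - t j) * a i j)
      (fun i j => by rw [has i j]; ring) (fun i => by simp)
    have h4 : ∑ i ∈ Finset.range n, ∑ j ∈ Finset.range n, t j * a i j = 0 := by
      rw [Finset.sum_comm, ← neg_eq_zero, ← Finset.sum_neg_distrib, ← hY]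
      refine Finset.sum_congr rfl fun i _ => ?_
      rw [← Finset.sum_neg_distrib]
      refine Finset.sum_congr rfl fun j _ => ?_
      rw [has j i]; ring
    simp only [sub_mul, Finset.sum_sub_distrib] at h3 ⊢
    rw [hY, h4] at h3
    linarith
  -- The function `(π - x) sin x` is nonnegative on `[0, 2π]`, which contains all the differences.
  have hterm : ∀ i ∈ Finset.range n, ∀ j ∈ Finset.range i,
      0 ≤ -((Real.pi - (t i - t j)) * a i j) := fun i hi j hj => by
    rw [Finset.mem_range] at hi hj
    have h3 := hmono hj
    have h4 := htn i hi
    have h5 := ht0 j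
    have h6 : 0 ≤ (Real.pi - (t i - t j)) * Real.sin (t i - t j) := by
      rcases le_total (t i - t j) Real.pi with h | h
      · exact mul_nonneg (by linarith) (Real.sin_nonneg_of_nonneg_of_le_pi (by linarith) h)
      · refine mul_nonneg_of_nonpos_of_nonpos (by linarith) ?_
        rw [← neg_nonneg, ← Real.sin_sub_pi]
        exact Real.sin_nonneg_of_nonneg_of_le_pi (by linarith) (by linarith)
    have h7 : D i j ≤ 0 := hJJ _ _
    have h8 := mul_nonneg h6 (neg_nonneg.2 h7)
    simp only [ha]
    linarith
  have htot : ∑ i ∈ Finset.range n, ∑ j ∈ Finset.range i, -((Real.pi - (t i - t j)) * a i j) = 0 := by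
    have : ∀ i j, -((Real.pi - (t i - t j)) * a i j) = (t i - t j) * a i j - Real.pi * a i j :=
      fun i j => by ring
    simp only [this, Finset.sum_sub_distrib, ← Finset.mul_sum]
    rw [hX, hY']
    simp
  have h3 := (Finset.sum_eq_zero_iff_of_nonneg
    (fun i hi => Finset.sum_nonneg (hterm i hi))).1 htot (i + 1) (Finset.mem_range.2 hi)
  have h4 := (Finset.sum_eq_zero_iff_of_nonneg
    (hterm (i + 1) (Finset.mem_range.2 hi))).1 h3 i (by simp)
  -- For neighbouring jumps the difference lies strictly between 0 and `π`, so the coefficient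
  -- cannot vanish and the product of the jumps must.
  have h5 : t (i + 1) - t i = α (i + 1) := by
    simp only [ht]; rw [hss (i + 1)]; ring
  simp only [ha, hD, h5, neg_eq_zero, mul_eq_zero] at h4
  have h6 := hα (i + 1)
  rcases h4 with h4 | h4 | h4
  · linarith [h6.2]
  · exact absurd h4 (Real.sin_pos_of_pos_of_lt_pi h6.1 h6.2).ne'
  · exact h4

end Fenchel

/-! ### Cycles, and the cyclic order of finitely many directions in the plane. -/

/-- A sequence running periodically around a simple cycle of length `k` of the relation `R`. -/
structure IsCycleSeq {V : Type*} (R : V → V → Prop) (k : ℕ) (c : ℕ → V) : Prop where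
  three_le : 3 ≤ k
  periodic : Function.Periodic c k
  injOn : Set.InjOn c (Set.Iio k)
  rel : ∀ i, R (c i) (c (i + 1))

section CyclicOrder

open ComplexConjugate

variable {F : Type*} {u : F → ℂ}

/-- Among the directions `u`, that of `g` comes next after that of `f`, at angle `β < π`. -/
structure IsNextDir (u : F → ℂ) (f g : F) (β : ℝ) : Prop where
  mem : β ∈ Set.Ioo 0 Real.pi
  eq : u g = Complex.exp (β * Complex.I) * u f
  ne : ∀ h γ, 0 < γ → γ < β → u h ≠ Complex.exp ((γ : ℝ) * Complex.I) * u f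

theorem conj_exp_mul_I (β : ℝ) :
    conj (Complex.exp (β * Complex.I)) = Complex.exp ((-β : ℝ) * Complex.I) := by
  rw [← Complex.exp_conj]; simp

theorem exp_mul_I_add (a b : ℝ) : Complex.exp ((a + b : ℝ) * Complex.I) =
    Complex.exp (a * Complex.I) * Complex.exp (b * Complex.I) := by
  rw [← Complex.exp_add]; push_cast; ring_nf

/-- Conjugation reverses the orientation of the plane, so statements about successors also yield
those about predecessors. -/
theorem isNextDir_conj {f g : F} {β : ℝ} :
    IsNextDir (fun f => conj (u f)) f g β ↔ IsNextDir u g f β := by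
  have key : ∀ {w : F → ℂ} {f g : F} {β : ℝ}, IsNextDir w g f β →
      IsNextDir (fun f => conj (w f)) f g β := fun {w f g β} h => by
    refine ⟨h.mem, ?_, fun x γ h0 h1 hx => ?_⟩
    · rw [h.eq, map_mul, conj_exp_mul_I, ← mul_assoc, ← exp_mul_I_add]
      simp
    · have h2 := congrArg conj hx
      simp only [map_mul, Complex.conj_conj, conj_exp_mul_I] at h2
      rw [h.eq, ← mul_assoc, ← exp_mul_I_add] at h2
      exact h.ne x (-γ + β) (by linarith) (by linarith) h2
  refine ⟨fun h => ?_, key⟩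
  simpa using key h

theorem IsNextDir.unique (hu : Function.Injective u) {f g g' : F} {β β' : ℝ}
    (h : IsNextDir u f g β) (h' : IsNextDir u f g' β') : g = g' := by
  have : β = β' := by
    rcases lt_trichotomy β β' with hlt | heq | hlt
    · exact absurd h.eq (h'.ne g β h.mem.1 hlt)
    · exact heq
    · exact absurd h'.eq (h.ne g' β' h'.mem.1 hlt)
  subst this
  exact hu (h.eq.trans h'.eq.symm)

/-- Following the cyclic order of finitely many directions, all gaps being less than `π`, one
passes once through all of them and makes one full turn. -/
theorem exists_full_turn [Finite F] (hu1 : ∀ f, ‖u f‖ = 1) (hu : Function.Injective u)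
    {nx : F → F} {β : F → ℝ} (hnx : ∀ f, IsNextDir u f (nx f) (β f)) (f : F) :
    ∃ n, 3 ≤ n ∧ nx^[n] f = f ∧ Set.InjOn (fun i => nx^[i] f) (Set.Iio n) ∧
      (∀ g, ∃ i < n, nx^[i] f = g) ∧ ∑ i ∈ Finset.range n, β (nx^[i] f) = 2 * Real.pi := by
  set s : ℕ → ℝ := fun n => ∑ i ∈ Finset.range n, β (nx^[i] f) with hs
  have hss : ∀ i, s (i + 1) = s i + β (nx^[i] f) := fun i => Finset.sum_range_succ _ _
  have hmono : StrictMono s := strictMono_nat_of_lt_succ fun i => by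
    rw [hss]; linarith [(hnx (nx^[i] f)).mem.1]
  have hu2 : ∀ i, u (nx^[i] f) = Complex.exp (s i * Complex.I) * u f := fun i => by
    induction i with
    | zero => simp [hs]
    | succ i ih =>
      rw [Function.iterate_succ_apply', (hnx _).eq, ih, hss, exp_mul_I_add]
      ring
  -- No direction lies strictly inside a gap, so the partial sums cannot jump over the angle of any
  -- direction, nor over the full turn.
  have hbetw : ∀ (g : F) (θ : ℝ) (i : ℕ), u g = Complex.exp (θ * Complex.I) * u f →
      s i < θ → s (i + 1) ≤ θ := fun g θ i hg h1 => by
    by_contra! h2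
    rw [hss] at h2
    refine (hnx (nx^[i] f)).ne g (θ - s i) (by linarith) (by linarith) ?_
    rw [hu2, ← mul_assoc, ← exp_mul_I_add, sub_add_cancel, hg]
  have : Nonempty F := ⟨f⟩
  obtain ⟨f₀, hf₀⟩ := Finite.exists_min β
  have hgrow : ∀ i : ℕ, i * β f₀ ≤ s i := fun i => by
    induction i with
    | zero => simp [hs]
    | succ i ih => rw [hss]; push_cast; linarith [hf₀ (nx^[i] f)]
  have hex : ∃ i, 2 * Real.pi ≤ s i := by
    obtain ⟨i, hi⟩ := Archimedean.arch (2 * Real.pi) (hnx f₀).mem.1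
    rw [nsmul_eq_mul] at hi
    exact ⟨i, hi.trans (hgrow i)⟩
  classical
  set n := Nat.find hex with hn
  have hn1 : 2 * Real.pi ≤ s n := Nat.find_spec hex
  have hn2 : ∀ i < n, s i < 2 * Real.pi := fun i hi => not_le.1 (Nat.find_min hex hi)
  have hs0 : s 0 = 0 := by simp [hs]
  have hnpos : 0 < n := by
    rcases Nat.eq_zero_or_pos n with h | h
    · rw [h, hs0] at hn1; linarith [Real.pi_pos]
    · exact h
  have hfull : Complex.exp ((2 * Real.pi : ℝ) * Complex.I) = 1 := by
    push_cast; exact Complex.exp_two_pi_mul_I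
  have hsn : s n = 2 * Real.pi := by
    refine le_antisymm ?_ hn1
    obtain ⟨m, hm⟩ := Nat.exists_eq_succ_of_ne_zero hnpos.ne'
    rw [hm]
    refine hbetw f _ m ?_ (hn2 m (by omega))
    rw [hfull, one_mul]
  have hu0 : ∀ g, u g ≠ 0 := fun g h => by have := hu1 g; simp [h] at this
  refine ⟨n, ?_, ?_, ?_, ?_, hsn⟩
  -- Two gaps, each less than `π`, do not make a full turn.
  · by_contra! h
    have h1 : s n ≤ s 2 := hmono.monotone (by omega)
    have h2 : s 2 = β f + β (nx f) := by simp [hs, Finset.sum_range_succ]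
    linarith [(hnx f).mem.2, (hnx (nx f)).mem.2]
  · apply hu
    rw [hu2, hsn, hfull, one_mul]
  · intro i hi j hj hij
    simp only [Set.mem_Iio] at hi hj hij
    have h1 := hu2 i
    rw [hij, hu2 j] at h1
    have h2 := mul_right_cancel₀ (hu0 f) h1
    rw [Complex.exp_eq_exp_iff_exists_int] at h2
    obtain ⟨m, hm⟩ := h2
    have h3 : s j = s i + m * (2 * Real.pi) := by
      have h4 : (s j : ℂ) * Complex.I = ((s i + m * (2 * Real.pi) : ℝ) : ℂ) * Complex.I := by
        rw [hm]; push_cast; ring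
      exact_mod_cast mul_right_cancel₀ Complex.I_ne_zero h4
    have h5 : ∀ i < n, 0 ≤ s i := fun i _ => hs0 ▸ hmono.monotone (Nat.zero_le i)
    have hm0 : m = 0 := by
      have hp := Real.pi_pos
      have h6 := h5 i hi; have h7 := h5 j hj; have h8 := hn2 i hi; have h9 := hn2 j hj
      have : (-1 : ℝ) < m := by by_contra! hc; nlinarith
      have h10 : (m : ℝ) < 1 := by by_contra! hc; nlinarith
      have h11 : (-1 : ℤ) < m := by exact_mod_cast this
      have h12 : m < 1 := by exact_mod_cast h10
      omega
    rw [hm0] at h3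
    exact hmono.injective (by simpa using h3.symm)
  · intro g
    obtain ⟨θ, hθ0, hθ1, hθ⟩ : ∃ θ : ℝ, 0 ≤ θ ∧ θ < 2 * Real.pi ∧
        u g = Complex.exp (θ * Complex.I) * u f := by
      set w := u g / u f with hw
      have hw1 : ‖w‖ = 1 := by rw [hw, norm_div, hu1, hu1, div_one]
      have h1 : Complex.exp (w.arg * Complex.I) = w := by
        have := Complex.norm_mul_exp_arg_mul_I w
        rwa [hw1, Complex.ofReal_one, one_mul] at this
      have h2 : u g = w * u f := by rw [hw, div_mul_cancel₀ _ (hu0 f)]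
      have h3 := Complex.neg_pi_lt_arg w
      have h4 := Complex.arg_le_pi w
      rcases le_or_gt 0 w.arg with h | h
      · exact ⟨w.arg, h, by linarith [Real.pi_pos], by rw [h1, h2]⟩
      · exact ⟨w.arg + 2 * Real.pi, by linarith, by linarith,
          by rw [exp_mul_I_add, hfull, mul_one, h1, h2]⟩
    have hex' : ∃ i, θ ≤ s i := ⟨n, by linarith⟩
    set i := Nat.find hex' with hi
    have hi1 : θ ≤ s i := Nat.find_spec hex'
    have hi3 : s i = θ := by
      refine le_antisymm ?_ hi1
      rcases Nat.eq_zero_or_pos i with h | h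
      · rw [h, hs0]; exact hθ0
      · obtain ⟨m, hm⟩ := Nat.exists_eq_succ_of_ne_zero h.ne'
        rw [hm]
        exact hbetw g θ m hθ (not_le.1 (Nat.find_min hex' (by omega)))
    refine ⟨i, hmono.lt_iff_lt.1 (by rw [hi3, hsn]; exact hθ1), hu ?_⟩
    rw [hu2, hi3, hθ]

/-- The successor map is a single orbit. A cycle that starts along it can only continue along it or
turn back, and turning back contradicts simplicity. -/
theorem exists_cycleSeq_of_isNextDir [Finite F] (hu1 : ∀ f, ‖u f‖ = 1)
    (hu : Function.Injective u) {R : F → F → Prop} {ext : F → F → ℝ}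
    (h1 : ∀ f g, R f g → IsNextDir u f g (ext f g) ∨ IsNextDir u g f (ext f g))
    (h2 : ∀ f, ∃ g, R f g ∧ IsNextDir u f g (ext f g)) {f g : F} (hfg : IsNextDir u f g (ext f g)) :
    ∃ c, IsCycleSeq R (Nat.card F) c ∧ c 0 = f ∧ c 1 = g ∧
      ∑ i ∈ Finset.range (Nat.card F), ext (c i) (c (i + 1)) = 2 * Real.pi ∧
      ∀ k d, IsCycleSeq R k d → d 0 = f → d 1 = g → k = Nat.card F ∧ d = c := by
  choose nx hR hnx using h2
  obtain ⟨n, h3, hn, hinj, hsurj, hsum⟩ := exists_full_turn hu1 hu hnx f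
  have hcard : Nat.card F = n := by
    have hbij : Function.Bijective (fun i : Fin n => nx^[i] f) := by
      refine ⟨fun i j hij => Fin.ext (hinj i.2 j.2 hij), fun g => ?_⟩
      obtain ⟨i, hi, h⟩ := hsurj g
      exact ⟨⟨i, hi⟩, h⟩
    rw [← Nat.card_congr (Equiv.ofBijective _ hbij), Nat.card_fin]
  have hg : g = nx f := hfg.unique hu (hnx f)
  have hnxs : Function.Surjective nx := fun x => by
    obtain ⟨i, hi, h⟩ := hsurj x
    rcases Nat.eq_zero_or_pos i with h0 | h0
    · obtain ⟨m, hm⟩ := Nat.exists_eq_succ_of_ne_zero (show n ≠ 0 by omega)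
      rw [h0, Function.iterate_zero_apply] at h
      rw [hm, Function.iterate_succ_apply'] at hn
      exact ⟨_, hn.trans h⟩
    · obtain ⟨m, hm⟩ := Nat.exists_eq_succ_of_ne_zero h0.ne'
      rw [hm, Function.iterate_succ_apply'] at h
      exact ⟨_, h⟩
  have hnxi : Function.Injective nx := Finite.injective_iff_surjective.2 hnxs
  rw [hcard]
  refine ⟨fun i => nx^[i] f, ⟨h3, fun i => ?_, hinj, fun i => ?_⟩, rfl, hg.symm, ?_, ?_⟩
  · rw [Function.iterate_add_apply, hn]
  · simp only [Function.iterate_succ_apply']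
    exact hR _
  · rw [← hsum]
    refine Finset.sum_congr rfl fun i _ => ?_
    simp only [Function.iterate_succ_apply']
  · intro k d hd hd0 hd1
    have hstep : ∀ i, d i = nx^[i] f ∧ d (i + 1) = nx^[i + 1] f := fun i => by
      induction i with
      | zero => exact ⟨hd0, hd1.trans hg⟩
      | succ i ih =>
        refine ⟨ih.2, ?_⟩
        rcases h1 _ _ (hd.rel (i + 1)) with h | h
        · rw [h.unique hu (hnx _), ih.2, ← Function.iterate_succ_apply' nx]
        -- Here the cycle would return to `d i` after two steps, although its length is at least 3.
        · exfalso
          have h4 := h.unique hu (hnx _)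
          rw [ih.2, Function.iterate_succ_apply', ← ih.1] at h4
          have h5 := hnxi h4
          have h6 : d (i % k) = d ((i + 2) % k) := by
            rw [hd.periodic.map_mod_nat, hd.periodic.map_mod_nat]; exact h5
          have hk := hd.three_le
          have h7 := hd.injOn (Set.mem_Iio.2 (Nat.mod_lt _ (by omega)))
            (Set.mem_Iio.2 (Nat.mod_lt _ (by omega))) h6
          have h8 : (i + 2) ≡ i [MOD k] := h7.symm
          have h9 : 2 ≡ 0 [MOD k] := Nat.ModEq.add_left_cancel' i (by simpa using h8)
          have := Nat.le_of_dvd (by norm_num) ((Nat.modEq_zero_iff_dvd).1 h9)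
          omega
    have hdc : d = fun i => nx^[i] f := funext fun i => (hstep i).1
    refine ⟨?_, hdc⟩
    have hk := hd.three_le
    rcases lt_trichotomy k n with h | h | h
    · have h4 : d k = d 0 := by simpa using hd.periodic 0
      rw [hdc] at h4
      have := hinj (Set.mem_Iio.2 h) (Set.mem_Iio.2 (by omega)) h4
      omega
    · exact h
    · have h4 : d n = d 0 := by rw [hdc]; exact hn
      have := hd.injOn (Set.mem_Iio.2 h) (Set.mem_Iio.2 (by omega)) h4
      omega

/-- The finite cyclic order of directions: the cycle through two neighbours is unique, it runs
through all directions and makes one full turn, and each direction has two neighbours. -/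
theorem existsUnique_cycleSeq [Finite F] (hu1 : ∀ f, ‖u f‖ = 1)
    (hu : Function.Injective u) {R : F → F → Prop} {ext : F → F → ℝ}
    (h1 : ∀ f g, R f g → IsNextDir u f g (ext f g) ∨ IsNextDir u g f (ext f g))
    (h2 : ∀ f, ∃ g, R f g ∧ IsNextDir u f g (ext f g))
    (h3 : ∀ f, ∃ g, R f g ∧ IsNextDir u g f (ext f g)) {f g : F} (hfg : R f g) :
    ∃ c, IsCycleSeq R (Nat.card F) c ∧ c 0 = f ∧ c 1 = g ∧
      ∑ i ∈ Finset.range (Nat.card F), ext (c i) (c (i + 1)) = 2 * Real.pi ∧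
      ∀ k d, IsCycleSeq R k d → d 0 = f → d 1 = g → k = Nat.card F ∧ d = c := by
  rcases h1 f g hfg with h | h
  · exact exists_cycleSeq_of_isNextDir hu1 hu h1 h2 h
  · refine exists_cycleSeq_of_isNextDir (u := fun f => conj (u f)) (fun f => by simp [hu1])
      (fun a b hab => hu (star_injective hab)) (fun a b hab => ?_) (fun a => ?_) (isNextDir_conj.2 h)
    · rw [isNextDir_conj, isNextDir_conj]; exact (h1 a b hab).symm
    · simpa only [isNextDir_conj] using h3 a

theorem encard_setOf_rel_eq_two (hu1 : ∀ f, ‖u f‖ = 1)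
    (hu : Function.Injective u) {R : F → F → Prop} {ext : F → F → ℝ}
    (h1 : ∀ f g, R f g → IsNextDir u f g (ext f g) ∨ IsNextDir u g f (ext f g))
    (h2 : ∀ f, ∃ g, R f g ∧ IsNextDir u f g (ext f g))
    (h3 : ∀ f, ∃ g, R f g ∧ IsNextDir u g f (ext f g)) (f : F) : {g | R f g}.encard = 2 := by
  obtain ⟨g, hg, hg'⟩ := h2 f
  obtain ⟨h, hh, hh'⟩ := h3 f
  refine Set.encard_eq_two.2 ⟨g, h, ?_, Set.ext fun x => ⟨fun hx => ?_, ?_⟩⟩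
  -- If successor and predecessor coincide, twice the gap is a multiple of `2π`, which is impossible
  -- for a gap in `(0, π)`.
  · rintro rfl
    have h4 := hg'.eq
    rw [hh'.eq, ← mul_assoc, ← exp_mul_I_add] at h4
    have h5 : u g ≠ 0 := fun h => by have := hu1 g; simp [h] at this
    have h6 : Complex.exp ((ext f g + ext f g : ℝ) * Complex.I) = 1 :=
      mul_right_cancel₀ h5 (by rw [one_mul]; exact h4.symm)
    rw [Complex.exp_eq_one_iff] at h6
    obtain ⟨n, hn⟩ := h6
    have h7 : ext f g + ext f g = n * (2 * Real.pi) := by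
      have h8 : ((ext f g + ext f g : ℝ) : ℂ) * Complex.I =
          ((n * (2 * Real.pi) : ℝ) : ℂ) * Complex.I := by
        rw [hn]; push_cast; ring
      exact_mod_cast mul_right_cancel₀ Complex.I_ne_zero h8
    have h9 := hg'.mem
    have hp := Real.pi_pos
    have h10 : (0 : ℝ) < n := by by_contra! hc; nlinarith [h9.1]
    have h11 : (n : ℝ) < 1 := by by_contra! hc; nlinarith [h9.2]
    have h12 : 0 < n := by exact_mod_cast h10
    have h13 : n < 1 := by exact_mod_cast h11
    omega
  · rcases h1 f x hx with h4 | h4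
    · exact Or.inl (h4.unique hu hg')
    · exact Or.inr ((isNextDir_conj.2 h4).unique (fun a b hab => hu (star_injective hab))
        (isNextDir_conj.2 hh'))
  · rintro (rfl | rfl)
    exacts [hg, hh]

end CyclicOrder

/-! ### The link of an ideal vertex as a convex polygon in the Euclidean plane. -/

namespace InfiniteIdealPolyhedron

variable {P : InfiniteIdealPolyhedron}

theorem norm_eq_one {x : E3} (hx : x ∈ P.vertices) : ‖x‖ = 1 := by
  simpa using P.subset_sphere hx

theorem inner_self_eq_one {x : E3} (hx : x ∈ P.vertices) : inner ℝ x x = (1 : ℝ) := by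
  rw [real_inner_self_eq_norm_sq, P.norm_eq_one hx]; norm_num

theorem inner_lt_one {x y : E3} (hx : x ∈ P.vertices) (hy : y ∈ P.vertices) (hxy : x ≠ y) :
    inner ℝ x y < (1 : ℝ) := by
  have := inner_lt_norm_mul_iff_real (x := x) (y := y)
  rw [P.norm_eq_one hx, P.norm_eq_one hy, one_smul, one_smul, one_mul] at this
  exact this.2 hxy

theorem inner_normal_self (f : P.Face) : inner ℝ f.normal f.normal = (1 : ℝ) := by
  rw [real_inner_self_eq_norm_sq, f.norm_normal]; norm_num

theorem inner_normal_le (f : P.Face) {x : E3} (hx : x ∈ P.vertices) :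
    inner ℝ f.normal x ≤ f.offset := f.supports x (subset_convexHull ℝ _ hx)

theorem exists_two_verts (f : P.Face) (v : E3) :
    ∃ x y, x ∈ f.verts ∧ y ∈ f.verts ∧ x ≠ v ∧ y ≠ v ∧ x ≠ y := by
  have h : 1 < (f.verts \ {v}).encard := by
    have h1 := f.three_le
    have h2 : f.verts.encard ≤ (f.verts \ {v}).encard + 1 := by
      by_cases hv : v ∈ f.verts
      · rw [Set.encard_sdiff_singleton_add_one hv]
      · rw [Set.sdiff_singleton_eq_self hv]; exact le_self_add
    have h3 : (3 : ℕ∞) ≤ (f.verts \ {v}).encard + 1 := h1.trans h2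
    by_contra! h4
    have h5 : (3 : ℕ∞) ≤ 1 + 1 := h3.trans (add_le_add_left h4 1)
    norm_num at h5
  obtain ⟨x, y, hx, hy, hxy⟩ := Set.one_lt_encard_iff.1 h
  exact ⟨x, y, hx.1, hy.1, hx.2, hy.2, hxy⟩

/-- The midpoint of two different vertices of the face lies on its plane and strictly inside the
ball. -/
theorem offset_sq_lt_one (f : P.Face) : f.offset ^ 2 < 1 := by
  obtain ⟨x, y, hx, hy, -, -, hxy⟩ := exists_two_verts f 0
  have h1 : inner ℝ f.normal (x + y) = 2 * f.offset := by
    rw [inner_add_right, hx.2, hy.2]; ring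
  have h2 := abs_real_inner_le_norm f.normal (x + y)
  rw [h1, f.norm_normal, one_mul] at h2
  have h3 : ‖x + y‖ ^ 2 < 4 := by
    rw [← real_inner_self_eq_norm_sq, real_inner_add_add_self, inner_self_eq_one hx.1,
      inner_self_eq_one hy.1]
    linarith [inner_lt_one hx.1 hy.1 hxy]
  have h4 := pow_le_pow_left₀ (abs_nonneg _) h2 2
  rw [sq_abs] at h4
  nlinarith

/-- The Lorentz norm of the normal vector of a face. -/
noncomputable def scale (f : P.Face) : ℝ := Real.sqrt (1 - f.offset ^ 2)

theorem scale_pos (f : P.Face) : 0 < scale f :=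
  Real.sqrt_pos.2 (by linarith [offset_sq_lt_one f])

theorem scale_sq (f : P.Face) : scale f ^ 2 = 1 - f.offset ^ 2 :=
  Real.sq_sqrt (by linarith [offset_sq_lt_one f])

theorem dihedral_eq (f g : P.Face) : Real.pi - f.dihedral g =
    Real.arccos ((inner ℝ f.normal g.normal - f.offset * g.offset) / (scale f * scale g)) := by
  unfold IdealFace.dihedral
  rw [neg_div, Real.arccos_neg]
  simp [scale]

section Link

variable (b : OrthonormalBasis (Fin 3) ℝ E3)

/-- Stereographic projection of the sphere from `b 2` to the link of that point. -/
noncomputable def linkPoint (x : E3) : ℂ :=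
  ⟨inner ℝ (b 0) x / (1 - inner ℝ (b 2) x), inner ℝ (b 1) x / (1 - inner ℝ (b 2) x)⟩

/-- The outward normal, in the link of `b 2`, of a face at `b 2`. -/
noncomputable def linkNormal (f : P.Face) : ℂ :=
  ⟨inner ℝ (b 0) f.normal / scale f, inner ℝ (b 1) f.normal / scale f⟩

/-- The Euclidean inner product of the plane. -/
def planeDot (w z : ℂ) : ℝ := w.re * z.re + w.im * z.im

/-- The area form of the plane. -/
def planeCross (w z : ℂ) : ℝ := w.re * z.im - w.im * z.re

theorem inner_eq_three (x y : E3) : inner ℝ x y = inner ℝ (b 0) x * inner ℝ (b 0) y +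
    inner ℝ (b 1) x * inner ℝ (b 1) y + inner ℝ (b 2) x * inner ℝ (b 2) y := by
  rw [← b.sum_inner_mul_inner x y, Fin.sum_univ_three]
  simp only [real_inner_comm x]

theorem ext_three {x y : E3} (h0 : inner ℝ (b 0) x = inner ℝ (b 0) y)
    (h1 : inner ℝ (b 1) x = inner ℝ (b 1) y) (h2 : inner ℝ (b 2) x = inner ℝ (b 2) y) : x = y := by
  apply b.repr.injective
  ext i
  rw [b.repr_apply_apply, b.repr_apply_apply]
  fin_cases i
  exacts [h0, h1, h2]

variable {b} {f g h : P.Face} {x y w : E3}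

theorem inner_normal_of_mem (hf : b 2 ∈ f.verts) : inner ℝ (b 2) f.normal = f.offset := by
  rw [real_inner_comm]; exact hf.2

theorem one_sub_inner_pos (hf : b 2 ∈ P.vertices) (hx : x ∈ P.vertices) (hxv : x ≠ b 2) :
    0 < 1 - inner ℝ (b 2) x := by
  linarith [inner_lt_one hf hx hxv.symm]

/-- Since the plane of `f` passes through the projection centre, its equation becomes that of a line
after division by the positive factor `1 - ⟪b 2, x⟫`. Supporting planes at `b 2` thus become
supporting lines of the projected vertex set. -/
theorem link_height (hf : b 2 ∈ f.verts) (hx : x ∈ P.vertices) (hxv : x ≠ b 2) :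
    inner ℝ f.normal x - f.offset = (1 - inner ℝ (b 2) x) *
      (scale f * planeDot (linkNormal b f) (linkPoint b x) - f.offset) := by
  have h1 := (one_sub_inner_pos hf.1 hx hxv).ne'
  have h2 := (scale_pos f).ne'
  rw [inner_eq_three b f.normal x, inner_normal_of_mem hf]
  simp only [planeDot, linkNormal, linkPoint]
  field_simp
  ring

theorem link_le (hf : b 2 ∈ f.verts) (hx : x ∈ P.vertices) (hxv : x ≠ b 2) :
    scale f * planeDot (linkNormal b f) (linkPoint b x) ≤ f.offset := by
  have h1 := one_sub_inner_pos hf.1 hx hxv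
  have h2 := link_height hf hx hxv
  have h3 := inner_normal_le f hx
  by_contra! h4
  nlinarith [mul_pos h1 (sub_pos.2 h4)]

theorem link_eq_iff (hf : b 2 ∈ f.verts) (hx : x ∈ P.vertices) (hxv : x ≠ b 2) :
    scale f * planeDot (linkNormal b f) (linkPoint b x) = f.offset ↔ x ∈ f.verts := by
  have h1 := one_sub_inner_pos hf.1 hx hxv
  have h2 := link_height hf hx hxv
  constructor
  · intro h
    rw [h, sub_self, mul_zero] at h2
    exact ⟨hx, by linarith⟩
  · intro h
    rw [h.2, sub_self, eq_comm, mul_eq_zero] at h2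
    rcases h2 with h2 | h2 <;> linarith

theorem planeDot_linkNormal (hf : b 2 ∈ f.verts) (hg : b 2 ∈ g.verts) :
    planeDot (linkNormal b f) (linkNormal b g) =
      (inner ℝ f.normal g.normal - f.offset * g.offset) / (scale f * scale g) := by
  have h1 := (scale_pos f).ne'
  have h2 := (scale_pos g).ne'
  rw [inner_eq_three b f.normal g.normal, inner_normal_of_mem hf, inner_normal_of_mem hg]
  simp only [planeDot, linkNormal]
  field_simp
  ring

theorem planeDot_linkNormal_self (hf : b 2 ∈ f.verts) :
    planeDot (linkNormal b f) (linkNormal b f) = 1 := by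
  rw [planeDot_linkNormal hf hf, inner_normal_self, ← sq, ← scale_sq, ← sq,
    div_self (pow_pos (scale_pos f) 2).ne']

theorem norm_linkNormal (hf : b 2 ∈ f.verts) : ‖linkNormal b f‖ = 1 := by
  have h := planeDot_linkNormal_self hf
  have h2 : ‖linkNormal b f‖ ^ 2 = 1 := by
    rw [Complex.sq_norm, Complex.normSq_apply]; exact h
  exact (pow_eq_one_iff_of_nonneg (norm_nonneg _) two_ne_zero).1 h2

theorem linkPoint_inj (hb : b 2 ∈ P.vertices) (hx : x ∈ P.vertices) (hy : y ∈ P.vertices)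
    (hxv : x ≠ b 2) (hyv : y ≠ b 2) (hxy : linkPoint b x = linkPoint b y) : x = y := by
  have h1 := one_sub_inner_pos hb hx hxv
  have h2 := one_sub_inner_pos hb hy hyv
  have hx1 := inner_self_eq_one hx
  have hy1 := inner_self_eq_one hy
  rw [inner_eq_three b] at hx1 hy1
  have e0 := congrArg Complex.re hxy
  have e1 := congrArg Complex.im hxy
  simp only [linkPoint] at e0 e1
  rw [div_eq_div_iff h1.ne' h2.ne'] at e0 e1
  set x0 := inner ℝ (b 0) x
  set x1 := inner ℝ (b 1) x
  set x2 := inner ℝ (b 2) x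
  set y0 := inner ℝ (b 0) y
  set y1 := inner ℝ (b 1) y
  set y2 := inner ℝ (b 2) y
  have h3 : (1 - x2) * (1 - y2) * (x2 - y2) = 0 := by
    have e2 : (x0 ^ 2 + x1 ^ 2) * (1 - y2) ^ 2 = (y0 ^ 2 + y1 ^ 2) * (1 - x2) ^ 2 := by
      linear_combination (x0 * (1 - y2) + y0 * (1 - x2)) * e0 + (x1 * (1 - y2) + y1 * (1 - x2)) * e1
    linear_combination (1/2) * e2 - (1/2) * (1 - y2) ^ 2 * hx1 + (1/2) * (1 - x2) ^ 2 * hy1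
  have h4 : x2 = y2 := by
    rcases mul_eq_zero.1 h3 with h | h
    · exact absurd h (mul_pos h1 h2).ne'
    · linarith
  rw [h4] at e0 e1 h1
  have h5 : x0 = y0 := mul_right_cancel₀ h1.ne' e0
  have h6 : x1 = y1 := mul_right_cancel₀ h1.ne' e1
  exact ext_three b h5 h6 h4

/-- Two supporting lines with the same outward normal coincide, so `offset / scale` agrees for both
faces. Together with `offset ^ 2 + scale ^ 2 = 1` this recovers the plane. -/
theorem linkNormal_inj (hf : b 2 ∈ f.verts) (hg : b 2 ∈ g.verts)
    (hfg : linkNormal b f = linkNormal b g) : f = g := by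
  obtain ⟨x, -, hx, -, hxv, -⟩ := exists_two_verts f (b 2)
  obtain ⟨y, -, hy, -, hyv, -⟩ := exists_two_verts g (b 2)
  have h1 := (link_eq_iff hf hx.1 hxv).2 hx
  have h2 := (link_eq_iff hg hy.1 hyv).2 hy
  have h3 := link_le hg hx.1 hxv
  have h4 := link_le hf hy.1 hyv
  rw [← hfg] at h2 h3
  have sf := scale_pos f
  have sg := scale_pos g
  have h5 : f.offset * scale g = g.offset * scale f := by
    refine le_antisymm ?_ ?_
    · rw [← h1]; nlinarith
    · rw [← h2]; nlinarith
  have h6 : scale f ^ 2 = scale g ^ 2 := by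
    have : (f.offset * scale g) ^ 2 = (g.offset * scale f) ^ 2 := by rw [h5]
    rw [mul_pow, mul_pow] at this
    have e1 := scale_sq f
    have e2 := scale_sq g
    have e3 : f.offset ^ 2 = 1 - scale f ^ 2 := by linarith
    have e4 : g.offset ^ 2 = 1 - scale g ^ 2 := by linarith
    rw [e3, e4] at this
    linarith
  have h7 : scale f = scale g := (sq_eq_sq₀ sf.le sg.le).1 h6
  have h8 : f.offset = g.offset := by
    rw [h7] at h5; exact mul_right_cancel₀ sg.ne' h5
  have e0 := congrArg Complex.re hfg
  have e1 := congrArg Complex.im hfg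
  simp only [linkNormal, h7] at e0 e1
  rw [div_left_inj' sg.ne'] at e0 e1
  exact IdealFace.ext (ext_three b e0 e1
    (by rw [inner_normal_of_mem hf, inner_normal_of_mem hg, h8])) h8

theorem planeDot_sq_add_planeCross_sq (w z : ℂ) :
    planeDot w z ^ 2 + planeCross w z ^ 2 = planeDot w w * planeDot z z := by
  simp only [planeDot, planeCross]; ring

theorem eq_planeDot_add_planeCross {w z : ℂ} (hw : planeDot w w = 1) :
    z = ⟨planeDot w z, planeCross w z⟩ * w := by
  have h : w.re ^ 2 + w.im ^ 2 = 1 := by rw [← hw]; simp only [planeDot]; ring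
  apply Complex.ext
  · simp only [planeDot, planeCross, Complex.mul_re]
    linear_combination -z.re * h
  · simp only [planeDot, planeCross, Complex.mul_im]
    linear_combination -z.im * h

/-- Parallel normals are equal or opposite. Equal ones belong to the same face. Opposite ones, with
a common point `w` of the lines, confine all vertices to one plane, whose face would be infinite. -/
theorem planeCross_ne_zero (hf : b 2 ∈ f.verts) (hg : b 2 ∈ g.verts) (hfg : f ≠ g)
    (hwf : w ∈ f.verts) (hwg : w ∈ g.verts) (hw : w ≠ b 2) :
    planeCross (linkNormal b f) (linkNormal b g) ≠ 0 := by
  intro h0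
  have h1 := planeDot_sq_add_planeCross_sq (linkNormal b f) (linkNormal b g)
  rw [h0, planeDot_linkNormal_self hf, planeDot_linkNormal_self hg] at h1
  have h2 := eq_planeDot_add_planeCross (z := linkNormal b g) (planeDot_linkNormal_self hf)
  rw [h0] at h2
  have h3 : planeDot (linkNormal b f) (linkNormal b g) = 1 ∨
      planeDot (linkNormal b f) (linkNormal b g) = -1 := by
    apply mul_self_eq_one_iff.1; nlinarith
  rcases h3 with h3 | h3
  · rw [h3] at h2
    refine hfg (linkNormal_inj hf hg ?_)
    rw [h2]; apply Complex.ext <;> simp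
  · rw [h3] at h2
    have hn : linkNormal b g = -linkNormal b f := by
      rw [h2]; apply Complex.ext <;> simp
    have hd : ∀ z, planeDot (-linkNormal b f) z = -planeDot (linkNormal b f) z := fun z => by
      simp only [planeDot, Complex.neg_re, Complex.neg_im]; ring
    have sf := scale_pos f
    have sg := scale_pos g
    have e1 := (link_eq_iff hf hwf.1 hw).2 hwf
    have e2 := (link_eq_iff hg hwf.1 hw).2 hwg
    rw [hn, hd] at e2
    refine P.infinite ((P.finite_verts f).subset fun x hx => ?_)
    by_cases hxv : x = b 2
    · rw [hxv]; exact hf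
    · rw [← link_eq_iff hf hx hxv]
      have e3 := link_le hf hx hxv
      have e4 := link_le hg hx hxv
      rw [hn, hd] at e4
      refine le_antisymm e3 ?_
      rw [← e1] at e3 ⊢
      rw [← e2] at e4
      nlinarith

end Link


theorem exists_basis {v : E3} (hv : ‖v‖ = 1) : ∃ b : OrthonormalBasis (Fin 3) ℝ E3, b 2 = v := by
  have h : Orthonormal ℝ (({2} : Set (Fin 3)).domRestrict fun _ => v) := by
    constructor
    · intro i; exact hv
    · intro i j hij
      exact absurd (Subsingleton.elim i j) hij
  obtain ⟨b, hb⟩ := h.exists_orthonormalBasis_extension_of_card_eq (by simp)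
  exact ⟨b, hb 2 rfl⟩

theorem planeDot_ext {w₁ w₂ z z' : ℂ} (h : planeCross w₁ w₂ ≠ 0)
    (h₁ : planeDot w₁ z = planeDot w₁ z') (h₂ : planeDot w₂ z = planeDot w₂ z') : z = z' := by
  simp only [planeDot, planeCross] at *
  apply Complex.ext
  · apply mul_left_cancel₀ h
    linear_combination w₂.im * h₁ - w₁.im * h₂
  · apply mul_left_cancel₀ h
    linear_combination w₁.re * h₂ - w₂.re * h₁

section Link

variable {b : OrthonormalBasis (Fin 3) ℝ E3} {f g h : P.Face} {x y w : E3}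

theorem planeDot_le (hf : b 2 ∈ f.verts) (hw : w ∈ f.verts) (hwv : w ≠ b 2)
    (hx : x ∈ P.vertices) (hxv : x ≠ b 2) :
    planeDot (linkNormal b f) (linkPoint b x) ≤ planeDot (linkNormal b f) (linkPoint b w) := by
  have h1 := link_le hf hx hxv
  rw [← (link_eq_iff hf hw.1 hwv).2 hw] at h1
  exact le_of_mul_le_mul_left h1 (scale_pos f)

theorem planeDot_eq (hf : b 2 ∈ f.verts) (hw : w ∈ f.verts) (hwv : w ≠ b 2)
    (hx : x ∈ f.verts) (hxv : x ≠ b 2) :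
    planeDot (linkNormal b f) (linkPoint b x) = planeDot (linkNormal b f) (linkPoint b w) :=
  le_antisymm (planeDot_le hf hw hwv hx.1 hxv) (planeDot_le hf hx hxv hw.1 hwv)

theorem eq_of_mem_of_mem (hf : b 2 ∈ f.verts) (hg : b 2 ∈ g.verts) (hfg : f ≠ g)
    (hwf : w ∈ f.verts) (hwg : w ∈ g.verts) (hw : w ≠ b 2)
    (hxf : x ∈ f.verts) (hxg : x ∈ g.verts) (hx : x ≠ b 2) : x = w :=
  linkPoint_inj hf.1 hxf.1 hwf.1 hx hw (planeDot_ext (planeCross_ne_zero hf hg hfg hwf hwg hw)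
    (planeDot_eq hf hwf hw hxf hx) (planeDot_eq hg hwg hw hxg hx))

theorem adj_of_mem (hf : b 2 ∈ f.verts) (hg : b 2 ∈ g.verts) (hfg : f ≠ g)
    (hwf : w ∈ f.verts) (hwg : w ∈ g.verts) (hw : w ≠ b 2) :
    (IdealFace.dualGraph P.vertices).Adj f g := by
  refine ⟨hfg, Set.encard_eq_two.2 ⟨b 2, w, hw.symm, Set.ext fun x => ⟨fun hx => ?_, ?_⟩⟩⟩
  · by_cases hxv : x = b 2
    · exact Or.inl hxv
    · exact Or.inr (eq_of_mem_of_mem hf hg hfg hwf hwg hw hx.1 hx.2 hxv)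
  · rintro (rfl | rfl)
    exacts [⟨hf, hg⟩, ⟨hwf, hwg⟩]

theorem exists_other (hfg : (IdealFace.dualGraph P.vertices).Adj f g) (v : E3) :
    ∃ w, w ∈ f.verts ∧ w ∈ g.verts ∧ w ≠ v := by
  obtain ⟨w, hw, hwv⟩ := Set.exists_ne_of_one_lt_encard
    (show 1 < (f.verts ∩ g.verts).encard by rw [hfg.2]; norm_num) v
  exact ⟨w, hw.1, hw.2, hwv⟩

/-- The lines of `f` and `g` meet at the corner `w` of the link. A supporting line with normal
strictly between theirs touches the link at `w` only, so it carries no face. -/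
theorem isNextDir_of_planeCross_pos (f g : {f : P.Face // b 2 ∈ f.verts})
    (hfg : (IdealFace.dualGraph P.vertices).Adj f.1 g.1)
    (hpos : 0 < planeCross (linkNormal b f.1) (linkNormal b g.1)) :
    IsNextDir (fun f : {f : P.Face // b 2 ∈ f.verts} => linkNormal b f.1) f g
      (Real.pi - f.1.dihedral g.1) := by
  obtain ⟨w, hwf, hwg, hw⟩ := exists_other hfg (b 2)
  have hmem := P.dihedral_mem f.1 g.1 hfg
  have hβ := dihedral_eq f.1 g.1
  rw [← planeDot_linkNormal f.2 g.2] at hβ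
  set β := Real.pi - f.1.dihedral g.1 with hβdef
  clear_value β
  have hβ0 : 0 < β := by linarith [hmem.2]
  have hβ1 : β < Real.pi := by linarith [hmem.1]
  have hsq := planeDot_sq_add_planeCross_sq (linkNormal b f.1) (linkNormal b g.1)
  rw [planeDot_linkNormal_self f.2, planeDot_linkNormal_self g.2, mul_one] at hsq
  have hcos : Real.cos β = planeDot (linkNormal b f.1) (linkNormal b g.1) := by
    rw [hβ, Real.cos_arccos] <;> nlinarith
  have hsin : Real.sin β = planeCross (linkNormal b f.1) (linkNormal b g.1) := by
    rw [hβ, Real.sin_arccos, show 1 - planeDot (linkNormal b f.1) (linkNormal b g.1) ^ 2 =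
      planeCross (linkNormal b f.1) (linkNormal b g.1) ^ 2 by linarith, Real.sqrt_sq hpos.le]
  have hexp : ∀ θ : ℝ, Complex.exp (θ * Complex.I) = ⟨Real.cos θ, Real.sin θ⟩ := fun θ => by
    apply Complex.ext
    · exact Complex.exp_ofReal_mul_I_re θ
    · exact Complex.exp_ofReal_mul_I_im θ
  have heq : linkNormal b g.1 = Complex.exp (β * Complex.I) * linkNormal b f.1 := by
    rw [hexp, hcos, hsin]
    exact eq_planeDot_add_planeCross (planeDot_linkNormal_self f.2)
  refine ⟨⟨hβ0, hβ1⟩, heq, fun h γ hγ0 hγ1 hh => ?_⟩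
  -- The intermediate normal is a combination of the two outer ones, and its coefficients are
  -- positive because `0 < γ < β < π`.
  have hlin : ∀ z, Real.sin β * planeDot (linkNormal b h.1) z =
      Real.sin (β - γ) * planeDot (linkNormal b f.1) z +
        Real.sin γ * planeDot (linkNormal b g.1) z := fun z => by
    rw [hh, heq, hexp, hexp, Real.sin_sub]
    simp only [planeDot, Complex.mul_re, Complex.mul_im]
    ring
  have hs0 : 0 < Real.sin β := Real.sin_pos_of_pos_of_lt_pi hβ0 hβ1
  have hs1 : 0 < Real.sin γ := Real.sin_pos_of_pos_of_lt_pi hγ0 (by linarith)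
  have hs2 : 0 < Real.sin (β - γ) := Real.sin_pos_of_pos_of_lt_pi (by linarith) (by linarith)
  have key : ∀ y ∈ h.1.verts, y ≠ b 2 → y = w := fun y hy hyv => by
    have e1 := planeDot_le h.2 hy hyv hwf.1 hw
    have e2 := planeDot_le f.2 hwf hw hy.1 hyv
    have e3 := planeDot_le g.2 hwg hw hy.1 hyv
    have e4 := mul_le_mul_of_nonneg_left e1 hs0.le
    rw [hlin, hlin] at e4
    have e5 := mul_le_mul_of_nonneg_left e2 hs2.le
    have e6 := mul_le_mul_of_nonneg_left e3 hs1.le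
    refine linkPoint_inj f.2.1 hy.1 hwf.1 hyv hw (planeDot_ext hpos.ne' ?_ ?_)
    · exact mul_left_cancel₀ hs2.ne' (le_antisymm e5 (by linarith))
    · exact mul_left_cancel₀ hs1.ne' (le_antisymm e6 (by linarith))
  obtain ⟨x, y, hx, hy, hxv, hyv, hxy⟩ := exists_two_verts h.1 (b 2)
  exact hxy ((key x hx hxv).trans (key y hy hyv).symm)

/-- Coordinates along the normal `u` and along its line. For two points on the line of `f` only the
cross terms differ. -/
theorem planeDot_split {u : ℂ} (hu : planeDot u u = 1) (w z : ℂ) :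
    planeDot w z = planeDot u w * planeDot u z + planeCross u w * planeCross u z := by
  simp only [planeDot, planeCross] at *
  linear_combination -(w.re * z.re + w.im * z.im) * hu

theorem planeCross_swap (w z : ℂ) : planeCross z w = -planeCross w z := by
  simp only [planeCross]; ring

/-- At the ideal vertex `b 2` each face has a neighbour on either side. -/
theorem exists_adj_planeCross (hf : b 2 ∈ f.verts) {ε : ℝ} (hε : ε ≠ 0) :
    ∃ g : P.Face, b 2 ∈ g.verts ∧ (IdealFace.dualGraph P.vertices).Adj f g ∧
      0 < ε * planeCross (linkNormal b f) (linkNormal b g) := by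
  set u := linkNormal b f with hu
  have hu1 : planeDot u u = 1 := planeDot_linkNormal_self hf
  obtain ⟨x₁, x₂, hx₁, hx₂, hx₁v, hx₂v, hx₁₂⟩ := exists_two_verts f (b 2)
  -- The extreme point of the link edge of `f` on the side chosen by the sign of `ε`; the chord from
  -- `b 2` to it will be a side of `f`.
  obtain ⟨w, ⟨hwf, hwv⟩, hmax⟩ := Set.exists_max_image (f.verts \ {b 2})
    (fun x => ε * planeCross u (linkPoint b x)) ((P.finite_verts f).subset Set.sdiff_subset)
    ⟨x₁, hx₁, hx₁v⟩
  have hwv : w ≠ b 2 := hwv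
  have hstrict : ∀ x ∈ f.verts, x ≠ b 2 →
      ε * planeCross u (linkPoint b x) = ε * planeCross u (linkPoint b w) → x = w :=
    fun x hx hxv h => by
      refine linkPoint_inj hf.1 hx.1 hwf.1 hxv hwv ?_
      rw [eq_planeDot_add_planeCross (z := linkPoint b x) hu1,
        eq_planeDot_add_planeCross (z := linkPoint b w) hu1, planeDot_eq hf hwf hwv hx hxv,
        mul_left_cancel₀ hε h]
  set d := ε * planeCross u (linkPoint b w) with hd
  -- The functional on space whose restriction to the sphere corresponds, under the projection, to
  -- `ε * planeCross u - d`.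
  set m : E3 := (-ε * u.im) • b 0 + (ε * u.re) • b 1 + d • b 2 with hm
  have hb : ∀ i j, inner ℝ (b i) (b j) = if i = j then (1 : ℝ) else 0 :=
    orthonormal_iff_ite.1 b.orthonormal
  have hmv : inner ℝ m (b 2) = d := by
    simp [hm, inner_add_left, real_inner_smul_left, hb]
  have hmx : ∀ x ∈ P.vertices, x ≠ b 2 → inner ℝ m x - d =
      (1 - inner ℝ (b 2) x) * (ε * planeCross u (linkPoint b x) - d) := fun x hx hxv => by
    have h1 := (one_sub_inner_pos hf.1 hx hxv).ne'
    simp only [hm, inner_add_left, real_inner_smul_left, planeCross, linkPoint]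
    field_simp
    ring
  have hside : f.IsSide (b 2) w := by
    refine ⟨hwv.symm, m, d, fun x hx => ?_, Set.ext fun x => ⟨fun hx => ?_, ?_⟩⟩
    · by_cases hxv : x = b 2
      · rw [hxv, hmv]
      · have h1 := hmx x hx.1 hxv
        have h2 := one_sub_inner_pos hf.1 hx.1 hxv
        have h3 := hmax x ⟨hx, hxv⟩
        nlinarith [mul_nonneg h2.le (sub_nonneg.2 h3)]
    · by_cases hxv : x = b 2
      · exact Or.inl hxv
      · have h1 := hmx x hx.1.1 hxv
        have h2 := one_sub_inner_pos hf.1 hx.1.1 hxv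
        rw [hx.2, sub_self, eq_comm, mul_eq_zero] at h1
        exact Or.inr (hstrict x hx.1 hxv (by rcases h1 with h1 | h1 <;> linarith))
    · rintro (rfl | rfl)
      · exact ⟨hf, hmv⟩
      · refine ⟨hwf, ?_⟩
        have h1 := hmx x hwf.1 hwv
        rw [hd] at h1 ⊢
        rw [sub_self, mul_zero] at h1
        linarith
  obtain ⟨g, hgf, hvg, hwg⟩ := P.exists_across f (b 2) w hside
  refine ⟨g, hvg, adj_of_mem hf hvg hgf.symm hwf hwg hwv, ?_⟩
  have hne := planeCross_ne_zero hf hvg hgf.symm hwf hwg hwv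
  obtain ⟨y, hy, hyv, hyw⟩ : ∃ y ∈ f.verts, y ≠ b 2 ∧ y ≠ w := by
    by_cases h : x₁ = w
    · exact ⟨x₂, hx₂, hx₂v, fun h' => hx₁₂ (h.trans h'.symm)⟩
    · exact ⟨x₁, hx₁, hx₁v, h⟩
  have h1 : ε * planeCross u (linkPoint b y) < ε * planeCross u (linkPoint b w) :=
    lt_of_le_of_ne (hmax y ⟨hy, hyv⟩) fun h => hyw (hstrict y hy hyv h)
  -- The line of `g` supports the link at `w` with the rest of the edge of `f` behind it, which
  -- fixes the side to which its normal is turned.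
  have h2 := planeDot_le hvg hwg hwv hy.1 hyv
  rw [planeDot_split hu1, planeDot_split hu1 _ (linkPoint b w), planeDot_eq hf hwf hwv hy hyv] at h2
  have h3 : 0 ≤ planeCross u (linkNormal b g) *
      (planeCross u (linkPoint b w) - planeCross u (linkPoint b y)) := by linarith
  have h4 : 0 < ε * (planeCross u (linkPoint b w) - planeCross u (linkPoint b y)) := by linarith
  by_contra! h5
  have h6 : ε * planeCross u (linkNormal b g) < 0 := lt_of_le_of_ne h5 (mul_ne_zero hε hne)
  nlinarith [mul_neg_of_neg_of_pos h6 h4, mul_nonneg (sq_nonneg ε) h3]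

theorem isNextDir_or (f g : {f : P.Face // b 2 ∈ f.verts})
    (hfg : (IdealFace.dualGraph P.vertices).Adj f.1 g.1) :
    IsNextDir (fun f : {f : P.Face // b 2 ∈ f.verts} => linkNormal b f.1) f g
      (Real.pi - f.1.dihedral g.1) ∨
    IsNextDir (fun f : {f : P.Face // b 2 ∈ f.verts} => linkNormal b f.1) g f
      (Real.pi - f.1.dihedral g.1) := by
  obtain ⟨w, hwf, hwg, hw⟩ := exists_other hfg (b 2)
  rcases lt_or_gt_of_ne (planeCross_ne_zero f.2 g.2 hfg.1 hwf hwg hw) with h | h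
  · right
    rw [IdealFace.dihedral_comm]
    exact isNextDir_of_planeCross_pos g f hfg.symm (by rw [planeCross_swap]; linarith)
  · exact Or.inl (isNextDir_of_planeCross_pos f g hfg h)

theorem linkNormal_injective :
    Function.Injective fun f : {f : P.Face // b 2 ∈ f.verts} => linkNormal b f.1 :=
  fun f g h => Subtype.ext (linkNormal_inj f.2 g.2 h)

/-- Both `g` and `h` pass through the same end `w` of the link edge of `f`, so their normals are
turned to the same side of that of `f`. Both then come next to `f` in the same direction. -/
theorem eq_of_adj_of_common (f g h : {f : P.Face // b 2 ∈ f.verts}) (hfg : f.1 ≠ g.1)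
    (hfh : f.1 ≠ h.1) (hwf : w ∈ f.1.verts) (hwg : w ∈ g.1.verts) (hwh : w ∈ h.1.verts)
    (hw : w ≠ b 2) : g = h := by
  have hu1 : planeDot (linkNormal b f.1) (linkNormal b f.1) = 1 := planeDot_linkNormal_self f.2
  obtain ⟨y, hy, hyv, hyw⟩ : ∃ y ∈ f.1.verts, y ≠ b 2 ∧ y ≠ w := by
    obtain ⟨x₁, x₂, hx₁, hx₂, hx₁v, hx₂v, hx₁₂⟩ := exists_two_verts f.1 (b 2)
    by_cases h : x₁ = w
    · exact ⟨x₂, hx₂, hx₂v, fun h' => hx₁₂ (h.trans h'.symm)⟩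
    · exact ⟨x₁, hx₁, hx₁v, h⟩
  have hdot := planeDot_eq f.2 hwf hw hy hyv
  have key : ∀ g : {f : P.Face // b 2 ∈ f.verts}, w ∈ g.1.verts →
      0 ≤ planeCross (linkNormal b f.1) (linkNormal b g.1) *
      (planeCross (linkNormal b f.1) (linkPoint b w) -
        planeCross (linkNormal b f.1) (linkPoint b y)) := fun g hwg => by
    have h2 := planeDot_le g.2 hwg hw hy.1 hyv
    rw [planeDot_split hu1, planeDot_split hu1 _ (linkPoint b w), hdot] at h2
    linarith
  have hne : planeCross (linkNormal b f.1) (linkPoint b w) ≠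
      planeCross (linkNormal b f.1) (linkPoint b y) := fun h => hyw <| by
    refine linkPoint_inj f.2.1 hy.1 hwf.1 hyv hw ?_
    rw [eq_planeDot_add_planeCross (z := linkPoint b y) hu1,
        eq_planeDot_add_planeCross (z := linkPoint b w) hu1, hdot, h]
  have kg := key g hwg
  have kh := key h hwh
  have ag := adj_of_mem f.2 g.2 hfg hwf hwg hw
  have ah := adj_of_mem f.2 h.2 hfh hwf hwh hw
  have ng := planeCross_ne_zero f.2 g.2 hfg hwf hwg hw
  have nh := planeCross_ne_zero f.2 h.2 hfh hwf hwh hw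
  rcases lt_or_gt_of_ne (sub_ne_zero.2 hne) with ht | ht
  · have pg : planeCross (linkNormal b f.1) (linkNormal b g.1) < 0 :=
      lt_of_le_of_ne (by by_contra! hc; nlinarith) ng
    have ph : planeCross (linkNormal b f.1) (linkNormal b h.1) < 0 :=
      lt_of_le_of_ne (by by_contra! hc; nlinarith) nh
    rw [planeCross_swap, neg_lt_zero] at pg ph
    exact (isNextDir_conj.2 (isNextDir_of_planeCross_pos g f ag.symm pg)).unique
      (fun a b hab => linkNormal_injective (star_injective hab))
      (isNextDir_conj.2 (isNextDir_of_planeCross_pos h f ah.symm ph))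
  · have pg : 0 < planeCross (linkNormal b f.1) (linkNormal b g.1) :=
      lt_of_le_of_ne (by by_contra! hc; nlinarith) ng.symm
    have ph : 0 < planeCross (linkNormal b f.1) (linkNormal b h.1) :=
      lt_of_le_of_ne (by by_contra! hc; nlinarith) nh.symm
    exact (isNextDir_of_planeCross_pos f g ag pg).unique linkNormal_injective
      (isNextDir_of_planeCross_pos f h ah ph)

theorem exists_isNextDir (f : {f : P.Face // b 2 ∈ f.verts}) :
    ∃ g : {f : P.Face // b 2 ∈ f.verts}, (IdealFace.dualGraph P.vertices).Adj f.1 g.1 ∧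
      IsNextDir (fun f : {f : P.Face // b 2 ∈ f.verts} => linkNormal b f.1) f g
        (Real.pi - f.1.dihedral g.1) := by
  obtain ⟨g, hg, hfg, hpos⟩ := exists_adj_planeCross f.2 one_ne_zero
  exact ⟨⟨g, hg⟩, hfg, isNextDir_of_planeCross_pos f ⟨g, hg⟩ hfg (by simpa using hpos)⟩

theorem exists_isNextDir' (f : {f : P.Face // b 2 ∈ f.verts}) :
    ∃ g : {f : P.Face // b 2 ∈ f.verts}, (IdealFace.dualGraph P.vertices).Adj f.1 g.1 ∧
      IsNextDir (fun f : {f : P.Face // b 2 ∈ f.verts} => linkNormal b f.1) g f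
        (Real.pi - f.1.dihedral g.1) := by
  obtain ⟨g, hg, hfg, hpos⟩ := exists_adj_planeCross f.2 (neg_ne_zero.2 one_ne_zero)
  refine ⟨⟨g, hg⟩, hfg, ?_⟩
  rw [IdealFace.dihedral_comm]
  exact isNextDir_of_planeCross_pos ⟨g, hg⟩ f hfg.symm (by rw [planeCross_swap]; linarith)

end Link

variable {f g h : P.Face} {v w : E3}

theorem eq_of_common_edge (hfg : f ≠ g) (hfh : f ≠ h) (hvw : w ≠ v) (hvf : v ∈ f.verts)
    (hvg : v ∈ g.verts) (hvh : v ∈ h.verts) (hwf : w ∈ f.verts) (hwg : w ∈ g.verts)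
    (hwh : w ∈ h.verts) : g = h := by
  obtain ⟨b, rfl⟩ := exists_basis (norm_eq_one hvf.1)
  exact congrArg Subtype.val
    (eq_of_adj_of_common ⟨f, hvf⟩ ⟨g, hvg⟩ ⟨h, hvh⟩ hfg hfh hwf hwg hwh hvw)

/-- The faces at an ideal vertex form a cycle with total exterior angle `2π`. -/
theorem existsUnique_cycleSeq_at (hfg : (IdealFace.dualGraph P.vertices).Adj f g)
    (hvf : v ∈ f.verts) (hvg : v ∈ g.verts) :
    ∃ c, IsCycleSeq (IdealFace.dualGraph P.vertices).Adj (P.vertexDegree v) c ∧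
      (∀ i, v ∈ (c i).verts) ∧ c 0 = f ∧ c 1 = g ∧
      ∑ i ∈ Finset.range (P.vertexDegree v), (Real.pi - (c i).dihedral (c (i + 1))) =
        2 * Real.pi ∧
      ∀ k d, IsCycleSeq (IdealFace.dualGraph P.vertices).Adj k d → (∀ i, v ∈ (d i).verts) →
        d 0 = f → d 1 = g → k = P.vertexDegree v ∧ d = c := by
  obtain ⟨b, rfl⟩ := exists_basis (norm_eq_one hvf.1)
  have : Finite {f : P.Face // b 2 ∈ f.verts} := P.finite_star (b 2) hvf.1
  obtain ⟨c, hc, h0, h1, hsum, huniq⟩ := existsUnique_cycleSeq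
    (u := fun f : {f : P.Face // b 2 ∈ f.verts} => linkNormal b f.1)
    (R := fun f g => (IdealFace.dualGraph P.vertices).Adj f.1 g.1)
    (ext := fun f g => Real.pi - f.1.dihedral g.1)
    (fun f => norm_linkNormal f.2) linkNormal_injective isNextDir_or exists_isNextDir
    exists_isNextDir' (f := ⟨f, hvf⟩) (g := ⟨g, hvg⟩) hfg
  have hcard : Nat.card {f : P.Face // b 2 ∈ f.verts} = P.vertexDegree (b 2) := rfl
  rw [hcard] at hc hsum huniq
  refine ⟨fun i => (c i).1, ⟨hc.three_le, fun i => congrArg Subtype.val (hc.periodic i),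
    fun i hi j hj hij => hc.injOn hi hj (Subtype.ext hij), hc.rel⟩, fun i => (c i).2,
    congrArg Subtype.val h0, congrArg Subtype.val h1, hsum, fun k d hd hdv hd0 hd1 => ?_⟩
  obtain ⟨hk, hdc⟩ := huniq k (fun i => ⟨d i, hdv i⟩)
    ⟨hd.three_le, fun i => Subtype.ext (hd.periodic i),
      fun i hi j hj hij => hd.injOn hi hj (congrArg Subtype.val hij), hd.rel⟩
    (Subtype.ext hd0) (Subtype.ext hd1)
  exact ⟨hk, funext fun i => congrArg Subtype.val (congrFun hdc i)⟩

theorem encard_adj_at (hvf : v ∈ f.verts) :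
    {g | (IdealFace.dualGraph P.vertices).Adj f g ∧ v ∈ g.verts}.encard = 2 := by
  obtain ⟨b, rfl⟩ := exists_basis (norm_eq_one hvf.1)
  have h := encard_setOf_rel_eq_two
    (u := fun f : {f : P.Face // b 2 ∈ f.verts} => linkNormal b f.1)
    (R := fun f g => (IdealFace.dualGraph P.vertices).Adj f.1 g.1)
    (ext := fun f g => Real.pi - f.1.dihedral g.1)
    (fun f => norm_linkNormal f.2) linkNormal_injective isNextDir_or exists_isNextDir
    exists_isNextDir' ⟨f, hvf⟩
  rw [← Subtype.val_injective.encard_image] at h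
  rw [← h]
  congr 1
  ext g
  simp [and_comm]

end InfiniteIdealPolyhedron

/-! ### Causal vectors in Minkowski space. -/

/-- The Minkowski product on `ℝ³ × ℝ`. -/
noncomputable def lorentz : (E3 × ℝ) →ₗ[ℝ] (E3 × ℝ) →ₗ[ℝ] ℝ :=
  LinearMap.mk₂ ℝ (fun x y => inner ℝ x.1 y.1 - x.2 * y.2)
    (fun x y z => by simp only [Prod.fst_add, Prod.snd_add, inner_add_left]; ring)
    (fun c x y => by
      simp only [Prod.smul_fst, Prod.smul_snd, real_inner_smul_left, smul_eq_mul]; ring)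
    (fun x y z => by simp only [Prod.fst_add, Prod.snd_add, inner_add_right]; ring)
    (fun c x y => by
      simp only [Prod.smul_fst, Prod.smul_snd, real_inner_smul_right, smul_eq_mul]; ring)

theorem lorentz_apply (x y : E3 × ℝ) : lorentz x y = inner ℝ x.1 y.1 - x.2 * y.2 := rfl

theorem lorentz_comm (x y : E3 × ℝ) : lorentz x y = lorentz y x := by
  rw [lorentz_apply, lorentz_apply, real_inner_comm, mul_comm]

theorem norm_le_of_lorentz_self_nonpos {x : E3 × ℝ} (hx : lorentz x x ≤ 0) (h0 : 0 < x.2) :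
    ‖x.1‖ ≤ x.2 := by
  rw [lorentz_apply, real_inner_self_eq_norm_sq] at hx
  exact abs_le_of_sq_le_sq' (by nlinarith) h0.le |>.2

theorem lorentz_nonpos {x y : E3 × ℝ} (hx : lorentz x x ≤ 0) (hx0 : 0 < x.2)
    (hy : lorentz y y ≤ 0) (hy0 : 0 < y.2) : lorentz x y ≤ 0 := by
  have h1 := norm_le_of_lorentz_self_nonpos hx hx0
  have h2 := norm_le_of_lorentz_self_nonpos hy hy0
  rw [lorentz_apply]
  linarith [real_inner_le_norm x.1 y.1, mul_le_mul h1 h2 (norm_nonneg _) hx0.le]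

/-- Orthogonality of future causal vectors is the equality case `⟪x.1, y.1⟫ = x.2 * y.2` of
Cauchy–Schwarz, which forces `‖x.1‖ = x.2`. -/
theorem lorentz_self_eq_zero {x y : E3 × ℝ} (hx : lorentz x x ≤ 0) (hx0 : 0 < x.2)
    (hy : lorentz y y ≤ 0) (hy0 : 0 < y.2) (hxy : lorentz x y = 0) : lorentz x x = 0 := by
  have h1 := norm_le_of_lorentz_self_nonpos hx hx0
  have h2 := norm_le_of_lorentz_self_nonpos hy hy0
  rw [lorentz_apply] at hxy
  have h3 : x.2 * y.2 ≤ ‖x.1‖ * y.2 := by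
    linarith [real_inner_le_norm x.1 y.1, mul_le_mul_of_nonneg_left h2 (norm_nonneg x.1)]
  have h4 : ‖x.1‖ = x.2 := le_antisymm h1 (le_of_mul_le_mul_right h3 hy0)
  rw [lorentz_apply, real_inner_self_eq_norm_sq, h4]
  ring

theorem snd_pos_of_lorentz_neg {x y : E3 × ℝ} (hx : lorentz x x ≤ 0)
    (hy : lorentz y y ≤ 0) (hy0 : 0 < y.2) (hxy : lorentz x y < 0) : 0 < x.2 := by
  by_contra! h
  have h2 := norm_le_of_lorentz_self_nonpos hy hy0
  rw [lorentz_apply, real_inner_self_eq_norm_sq] at hx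
  rw [lorentz_apply] at hxy
  have h1 : ‖x.1‖ ≤ -x.2 := abs_le_of_sq_le_sq' (by nlinarith) (by linarith) |>.2
  have h3 := (abs_le.1 (abs_real_inner_le_norm x.1 y.1)).1
  linarith [mul_le_mul h1 h2 (norm_nonneg _) (by linarith : 0 ≤ -x.2)]

/-- The expansion of a vector orthogonal to `N` in the Lorentz basis `A, B, ν` of the complement
of `N`, where `A, B` are lightlike. -/
theorem lorentz_expansion {N ν A B X : E3 × ℝ} (hN : lorentz N N = 1) (hν : lorentz ν ν = 1)
    (hNν : lorentz N ν = 0) (hNA : lorentz N A = 0) (hNB : lorentz N B = 0)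
    (hνA : lorentz ν A = 0) (hνB : lorentz ν B = 0) (hA : lorentz A A = 0) (hB : lorentz B B = 0)
    (hAB : lorentz A B ≠ 0) (hX : lorentz X N = 0) :
    X = (lorentz X B / lorentz A B) • A + (lorentz X A / lorentz A B) • B + lorentz X ν • ν := by
  have hνN := (lorentz_comm ν N).trans hNν
  have hAN := (lorentz_comm A N).trans hNA
  have hBN := (lorentz_comm B N).trans hNB
  have hAν := (lorentz_comm A ν).trans hνA
  have hBν := (lorentz_comm B ν).trans hνB
  have hBA := lorentz_comm B A
  have hli : LinearIndependent ℝ ![N, ν, A, B] := by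
    rw [Fintype.linearIndependent_iff]
    intro g hg
    simp only [Fin.sum_univ_four, Matrix.cons_val] at hg
    have key : ∀ Y, g 0 * lorentz N Y + g 1 * lorentz ν Y + g 2 * lorentz A Y +
        g 3 * lorentz B Y = 0 := fun Y => by
      have := congrArg (fun Z => lorentz Z Y) hg
      simpa using this
    have k0 := key N
    have k1 := key ν
    have k2 := key A
    have k3 := key B
    simp only [hN, hν, hNν, hNA, hNB, hνA, hνB, hA, hB, hνN, hAN, hBN, hAν, hBν, hBA,
      mul_zero, mul_one, add_zero, zero_add, mul_eq_zero, hAB, or_false] at k0 k1 k2 k3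
    intro i
    fin_cases i
    exacts [k0, k1, k3, k2]
  have hspan := hli.span_eq_top_of_card_eq_finrank (by simp)
  rw [← sub_eq_zero]
  set R := X - ((lorentz X B / lorentz A B) • A + (lorentz X A / lorentz A B) • B +
    lorentz X ν • ν) with hR
  have hRY : ∀ Y, lorentz R Y = lorentz X Y - (lorentz X B / lorentz A B * lorentz A Y +
      lorentz X A / lorentz A B * lorentz B Y + lorentz X ν * lorentz ν Y) := fun Y => by
    simp [hR]
  have hle : Submodule.span ℝ (Set.range ![N, ν, A, B]) ≤ LinearMap.ker (lorentz R) := by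
    rw [Submodule.span_le]
    rintro _ ⟨i, rfl⟩
    rw [SetLike.mem_coe, LinearMap.mem_ker]
    fin_cases i
    · change lorentz R N = 0
      rw [hRY, hX, hAN, hBN, hνN]; ring
    · change lorentz R ν = 0
      rw [hRY, hAν, hBν, hν]; ring
    · change lorentz R A = 0
      rw [hRY, hA, hBA, hνA]; field_simp; ring
    · change lorentz R B = 0
      rw [hRY, hB, hνB]; field_simp; ring
  rw [hspan] at hle
  -- Reversing the time coordinate turns the Minkowski product into the positive definite one, so
  -- orthogonality to everything gives `R = 0`.
  have h0 : lorentz R (R.1, -R.2) = 0 := hle (Submodule.mem_top (x := (R.1, -R.2)))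
  rw [lorentz_apply, real_inner_self_eq_norm_sq] at h0
  have h1 : ‖R.1‖ = 0 := by
    have : ‖R.1‖ ^ 2 = 0 := by nlinarith [sq_nonneg ‖R.1‖, sq_nonneg R.2]
    exact pow_eq_zero_iff two_ne_zero |>.1 this
  have h2 : R.2 = 0 := by
    have : R.2 ^ 2 = 0 := by nlinarith [sq_nonneg ‖R.1‖, sq_nonneg R.2]
    exact pow_eq_zero_iff two_ne_zero |>.1 this
  exact Prod.ext (norm_eq_zero.1 h1) h2

/-! ### Normals of faces and of their edges in Minkowski space. -/

namespace InfiniteIdealPolyhedron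

variable {P : InfiniteIdealPolyhedron} {f g h : P.Face} {v w x : E3}

/-- The outward unit normal of a face in Minkowski space. -/
noncomputable def unitNormal (f : P.Face) : E3 × ℝ := (scale f)⁻¹ • (f.normal, f.offset)

/-- The exterior dihedral angle. -/
noncomputable def exterior (f g : P.Face) : ℝ := Real.pi - f.dihedral g

/-- The unit normal of the common edge of `f` and `g` inside the plane of `f`, outward from `f`. -/
noncomputable def edgeNormal (f g : P.Face) : E3 × ℝ :=
  (Real.sin (exterior f g))⁻¹ • (unitNormal g - Real.cos (exterior f g) • unitNormal f)

theorem exterior_comm (f g : P.Face) : exterior f g = exterior g f := by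
  rw [exterior, exterior, IdealFace.dihedral_comm]

theorem exterior_mem (hfg : (IdealFace.dualGraph P.vertices).Adj f g) :
    exterior f g ∈ Set.Ioo 0 Real.pi := by
  have := P.dihedral_mem f g hfg
  exact ⟨by unfold exterior; linarith [this.2], by unfold exterior; linarith [this.1]⟩

theorem lorentz_unitNormal_self (f : P.Face) : lorentz (unitNormal f) (unitNormal f) = 1 := by
  simp only [unitNormal, map_smul, LinearMap.smul_apply, lorentz_apply, smul_eq_mul]
  have h1 := (scale_pos f).ne'
  have h2 := scale_sq f
  rw [inner_normal_self]
  field_simp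
  linarith

theorem lorentz_unitNormal (f g : P.Face) : lorentz (unitNormal f) (unitNormal g) =
    (inner ℝ f.normal g.normal - f.offset * g.offset) / (scale f * scale g) := by
  simp only [unitNormal, map_smul, LinearMap.smul_apply, lorentz_apply, smul_eq_mul]
  have h1 := (scale_pos f).ne'
  have h2 := (scale_pos g).ne'
  field_simp

theorem cos_exterior (hfg : (IdealFace.dualGraph P.vertices).Adj f g) :
    Real.cos (exterior f g) = lorentz (unitNormal f) (unitNormal g) := by
  have h1 := exterior_mem hfg
  have h2 := dihedral_eq f g
  rw [lorentz_unitNormal]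
  change exterior f g = _ at h2
  rw [h2] at h1 ⊢
  refine Real.cos_arccos ?_ ?_
  · by_contra! hc
    rw [Real.arccos_of_le_neg_one hc.le] at h1
    exact lt_irrefl _ h1.2
  · by_contra! hc
    rw [Real.arccos_of_one_le hc.le] at h1
    exact lt_irrefl _ h1.1

theorem lorentz_unitNormal_vertex (f : P.Face) (x : E3) :
    lorentz (unitNormal f) (x, 1) = (scale f)⁻¹ * (inner ℝ f.normal x - f.offset) := by
  simp [unitNormal, lorentz_apply, real_inner_smul_left]
  ring

theorem lorentz_unitNormal_vertex_nonpos (f : P.Face) (hx : x ∈ P.vertices) :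
    lorentz (unitNormal f) (x, 1) ≤ 0 := by
  rw [lorentz_unitNormal_vertex]
  exact mul_nonpos_of_nonneg_of_nonpos (inv_pos.2 (scale_pos f)).le
    (by linarith [inner_normal_le f hx])

theorem lorentz_unitNormal_vertex_eq_zero (hx : x ∈ P.vertices) :
    lorentz (unitNormal f) (x, 1) = 0 ↔ x ∈ f.verts := by
  rw [lorentz_unitNormal_vertex, mul_eq_zero, or_iff_right (inv_pos.2 (scale_pos f)).ne', sub_eq_zero]
  exact ⟨fun h => ⟨hx, h⟩, fun h => h.2⟩

theorem lorentz_edgeNormal_vertex (hx : x ∈ f.verts) (g : P.Face) :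
    lorentz (edgeNormal f g) (x, 1) =
      (Real.sin (exterior f g))⁻¹ * lorentz (unitNormal g) (x, 1) := by
  simp only [edgeNormal, map_smul, map_sub, LinearMap.smul_apply, LinearMap.sub_apply, smul_eq_mul,
    (lorentz_unitNormal_vertex_eq_zero hx.1).2 hx]
  ring

theorem sin_exterior_pos (hfg : (IdealFace.dualGraph P.vertices).Adj f g) :
    0 < Real.sin (exterior f g) :=
  Real.sin_pos_of_pos_of_lt_pi (exterior_mem hfg).1 (exterior_mem hfg).2

theorem lorentz_edgeNormal_vertex_nonpos (hfg : (IdealFace.dualGraph P.vertices).Adj f g)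
    (hx : x ∈ f.verts) : lorentz (edgeNormal f g) (x, 1) ≤ 0 := by
  rw [lorentz_edgeNormal_vertex hx]
  exact mul_nonpos_of_nonneg_of_nonpos (inv_pos.2 (sin_exterior_pos hfg)).le
    (lorentz_unitNormal_vertex_nonpos g hx.1)

theorem lorentz_edgeNormal_vertex_eq_zero (hfg : (IdealFace.dualGraph P.vertices).Adj f g)
    (hx : x ∈ f.verts) : lorentz (edgeNormal f g) (x, 1) = 0 ↔ x ∈ g.verts := by
  rw [lorentz_edgeNormal_vertex hx, mul_eq_zero, or_iff_right (inv_pos.2 (sin_exterior_pos hfg)).ne',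
    lorentz_unitNormal_vertex_eq_zero hx.1]

theorem lorentz_unitNormal_edgeNormal (hfg : (IdealFace.dualGraph P.vertices).Adj f g) :
    lorentz (unitNormal f) (edgeNormal f g) = 0 := by
  simp only [edgeNormal, map_smul, map_sub, smul_eq_mul, lorentz_unitNormal_self,
    ← cos_exterior hfg]
  ring

theorem lorentz_edgeNormal_self (hfg : (IdealFace.dualGraph P.vertices).Adj f g) :
    lorentz (edgeNormal f g) (edgeNormal f g) = 1 := by
  have h1 := (sin_exterior_pos hfg).ne'
  simp only [edgeNormal, map_smul, map_sub, smul_eq_mul, LinearMap.smul_apply, LinearMap.sub_apply,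
    lorentz_unitNormal_self, ← cos_exterior hfg, lorentz_comm (unitNormal g) (unitNormal f)]
  have h2 := Real.sin_sq_add_cos_sq (exterior f g)
  field_simp
  linear_combination -h2

theorem lorentz_vertex_self (hx : x ∈ P.vertices) : lorentz (x, 1) (x, 1) = 0 := by
  simp [lorentz_apply, norm_eq_one hx]

theorem lorentz_vertex_neg (hx : x ∈ P.vertices) (hw : w ∈ P.vertices) (hxw : x ≠ w) :
    lorentz (x, 1) (w, 1) < 0 := by
  rw [lorentz_apply]
  simpa using inner_lt_one hx hw hxw

/-- The sum of the outward normals of two edges of a face is future causal, and it is lightlike only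
in the direction of a common vertex. -/
theorem edgeNormal_add (hfg : (IdealFace.dualGraph P.vertices).Adj f g)
    (hfh : (IdealFace.dualGraph P.vertices).Adj f h) (hgh : g ≠ h) :
    lorentz (edgeNormal f g + edgeNormal f h) (edgeNormal f g + edgeNormal f h) ≤ 0 ∧
    0 < (edgeNormal f g + edgeNormal f h).2 ∧
    (lorentz (edgeNormal f g + edgeNormal f h) (edgeNormal f g + edgeNormal f h) = 0 →
      ∃ v ∈ f.verts, ∃ p > 0, edgeNormal f g + edgeNormal f h = (p : ℝ) • ((v, 1) : E3 × ℝ)) := by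
  obtain ⟨a, b, hab, hE⟩ := Set.encard_eq_two.1 hfg.2
  have ha : a ∈ f.verts ∩ g.verts := by rw [hE]; simp
  have hb : b ∈ f.verts ∩ g.verts := by rw [hE]; simp
  -- Different sides of `f` cannot have both ends in common, as three faces never share an edge.
  obtain ⟨c, hcf, hch, hcg⟩ : ∃ c ∈ f.verts, c ∈ h.verts ∧ c ∉ g.verts := by
    by_contra! hc
    obtain ⟨x, y, hxy, hE'⟩ := Set.encard_eq_two.1 hfh.2
    have hx : x ∈ f.verts ∩ h.verts := by rw [hE']; simp
    have hy : y ∈ f.verts ∩ h.verts := by rw [hE']; simp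
    exact hgh (eq_of_common_edge hfg.1 hfh.1 hxy hy.1 (hc y hy.1 hy.2) hy.2 hx.1
      (hc x hx.1 hx.2) hx.2)
  set A : E3 × ℝ := (a, 1) with hA
  set B : E3 × ℝ := (b, 1) with hB
  set C : E3 × ℝ := (c, 1) with hC
  set N := unitNormal f with hN
  set ν := edgeNormal f g with hν
  set ν' := edgeNormal f h with hν'
  have hνν := lorentz_edgeNormal_self hfg
  have hνν' := lorentz_edgeNormal_self hfh
  have hAB : lorentz A B < 0 := lorentz_vertex_neg ha.1.1 hb.1.1 hab
  have hAC : lorentz A C < 0 :=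
    lorentz_vertex_neg ha.1.1 hcf.1 (by rintro rfl; exact hcg ha.2)
  have hBC : lorentz B C < 0 :=
    lorentz_vertex_neg hb.1.1 hcf.1 (by rintro rfl; exact hcg hb.2)
  have hνC : lorentz ν C < 0 := lt_of_le_of_ne (lorentz_edgeNormal_vertex_nonpos hfg hcf)
    fun h => hcg ((lorentz_edgeNormal_vertex_eq_zero hfg hcf).1 h)
  have hν'C : lorentz ν' C = 0 := (lorentz_edgeNormal_vertex_eq_zero hfh hcf).2 hch
  have hνA : lorentz ν A = 0 := (lorentz_edgeNormal_vertex_eq_zero hfg ha.1).2 ha.2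
  have hνB : lorentz ν B = 0 := (lorentz_edgeNormal_vertex_eq_zero hfg hb.1).2 hb.2
  have hν'A : lorentz ν' A ≤ 0 := lorentz_edgeNormal_vertex_nonpos hfh ha.1
  have hν'B : lorentz ν' B ≤ 0 := lorentz_edgeNormal_vertex_nonpos hfh hb.1
  have hexp := lorentz_expansion (X := ν') (lorentz_unitNormal_self f) hνν
    (lorentz_unitNormal_edgeNormal hfg)
    ((lorentz_unitNormal_vertex_eq_zero ha.1.1).2 ha.1)
    ((lorentz_unitNormal_vertex_eq_zero hb.1.1).2 hb.1) hνA hνB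
    (lorentz_vertex_self ha.1.1) (lorentz_vertex_self hb.1.1) hAB.ne
    ((lorentz_comm _ _).trans (lorentz_unitNormal_edgeNormal hfh))
  set p := lorentz ν' B / lorentz A B with hp
  set q := lorentz ν' A / lorentz A B with hq
  set r := lorentz ν' ν with hr
  have hp0 : 0 ≤ p := div_nonneg_of_nonpos hν'B hAB.le
  have hq0 : 0 ≤ q := div_nonneg_of_nonpos hν'A hAB.le
  have hAA : lorentz A A = 0 := lorentz_vertex_self ha.1.1
  have hBB : lorentz B B = 0 := lorentz_vertex_self hb.1.1
  have hexp : ν' = p • A + q • B + r • ν := hexp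
  have e1 : ∀ Y, lorentz ν' Y = p * lorentz A Y + q * lorentz B Y + r * lorentz ν Y := fun Y => by
    conv_lhs => rw [hexp]
    simp only [map_add, map_smul, LinearMap.add_apply, LinearMap.smul_apply, smul_eq_mul]
  -- The unit length of `ν'`. As `p * q ≥ 0` and `lorentz A B < 0`, it gives `r ^ 2 ≥ 1`, and the
  -- vertex `c` off the first side excludes `r > 0`. So `r ≤ -1`: the sides do not cross.
  have e2 : r ^ 2 + 2 * p * q * lorentz A B = 1 := by
    have h1 := e1 ν'
    rw [hνν', lorentz_comm A, lorentz_comm B, lorentz_comm ν, e1 A, e1 B, hAA, hBB, hνA, hνB,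
      lorentz_comm B A] at h1
    linarith
  have e3 := e1 C
  rw [hν'C] at e3
  have hr0 : r ≤ 0 := by
    by_contra! h0
    nlinarith [mul_neg_of_pos_of_neg h0 hνC, mul_nonneg hp0 (neg_pos.2 hAC).le,
      mul_nonneg hq0 (neg_pos.2 hBC).le]
  have hpq : 0 ≤ p * q * -lorentz A B := mul_nonneg (mul_nonneg hp0 hq0) (neg_pos.2 hAB).le
  have hr1 : r ≤ -1 := by nlinarith
  have hJJ : lorentz (ν + ν') (ν + ν') = 2 + 2 * r := by
    simp only [map_add, LinearMap.add_apply]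
    rw [hνν, hνν', lorentz_comm ν ν']
    ring
  have hpq0 : p + q ≠ 0 := fun h0 => by
    have hp1 : p = 0 := by linarith
    have hq1 : q = 0 := by linarith
    rw [hp1, hq1] at e3
    have : r * lorentz ν C = 0 := by linarith
    rcases mul_eq_zero.1 this with h | h <;> linarith
  refine ⟨by rw [hJJ]; linarith, ?_, fun h0 => ?_⟩
  -- The time orientation is tested against `A + B`, which is future timelike.
  · refine snd_pos_of_lorentz_neg (y := A + B) (by rw [hJJ]; linarith) ?_ (by simp [hA, hB]) ?_
    · simp only [map_add, LinearMap.add_apply, hAA, hBB, lorentz_comm B A]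
      linarith
    · simp only [map_add, LinearMap.add_apply, hνA, hνB]
      have h1 : p * lorentz A B = lorentz ν' B := div_mul_cancel₀ _ hAB.ne
      have h2 : q * lorentz A B = lorentz ν' A := div_mul_cancel₀ _ hAB.ne
      have h3 : 0 < p + q := lt_of_le_of_ne (by linarith) hpq0.symm
      nlinarith [mul_neg_of_pos_of_neg h3 hAB]
  -- In the lightlike case the `ν` components cancel and `p * q = 0`, so only a multiple of one end
  -- of the first side remains.
  · have hr2 : r = -1 := by linarith
    have h1 : p * q = 0 := by
      have : p * q * lorentz A B = 0 := by rw [hr2] at e2; linarith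
      exact (mul_eq_zero.1 this).resolve_right hAB.ne
    rw [hr2] at hexp
    rcases mul_eq_zero.1 h1 with h2 | h2
    · refine ⟨b, hb.1, q, lt_of_le_of_ne hq0 fun h => hpq0 (by rw [h2, ← h, add_zero]), ?_⟩
      rw [hexp, h2]
      module
    · refine ⟨a, ha.1, p, lt_of_le_of_ne hp0 fun h => hpq0 (by rw [h2, ← h, add_zero]), ?_⟩
      rw [hexp, h2]
      module

end InfiniteIdealPolyhedron

/-! ### Cycles of faces with total exterior angle `2π`. -/

theorem IsCycleSeq.modEq_of_eq {V : Type*} {R : V → V → Prop} {k : ℕ} {c : ℕ → V}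
    (hc : IsCycleSeq R k c) {i j : ℕ} (h : c i = c j) : i ≡ j [MOD k] := by
  have hk := hc.three_le
  refine hc.injOn (Set.mem_Iio.2 (Nat.mod_lt _ (by omega)))
    (Set.mem_Iio.2 (Nat.mod_lt _ (by omega))) ?_
  rw [hc.periodic.map_mod_nat, hc.periodic.map_mod_nat, h]

namespace InfiniteIdealPolyhedron

variable {P : InfiniteIdealPolyhedron}

/-- A cycle of faces with total exterior angle `2π` runs around an ideal vertex. -/
theorem exists_common_vertex {k : ℕ} {c : ℕ → P.Face}
    (hc : IsCycleSeq (IdealFace.dualGraph P.vertices).Adj k c)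
    (hsum : ∑ i ∈ Finset.range k, exterior (c i) (c (i + 1)) = 2 * Real.pi) :
    ∃ v, ∀ i, v ∈ (c i).verts := by
  have hk := hc.three_le
  -- The predecessor of `c i` is written with index `i + k - 1`, which is meaningful also for `i =
  -- 0`.
  have hprev : ∀ i, (IdealFace.dualGraph P.vertices).Adj (c i) (c (i + k - 1)) := fun i => by
    have h := (hc.rel (i + k - 1)).symm
    rw [show i + k - 1 + 1 = i + k by omega, hc.periodic] at h
    exact h
  have hne : ∀ i, c (i + 1) ≠ c (i + k - 1) := fun i h => by
    have h1 := hc.modEq_of_eq h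
    rw [show i + k - 1 = (i + 1) + (k - 2) by omega] at h1
    have h2 : 0 ≡ k - 2 [MOD k] := Nat.ModEq.add_left_cancel' (i + 1) (by simpa using h1)
    have := Nat.le_of_dvd (by omega) ((Nat.modEq_zero_iff_dvd).1 h2.symm)
    omega
  set J : ℕ → E3 × ℝ := fun i =>
    edgeNormal (c i) (c (i + 1)) + edgeNormal (c i) (c (i + k - 1)) with hJ
  have hspec := fun i => edgeNormal_add (hc.rel i) (hprev i) (hne i)
  have horth := jump_orthogonal (N := fun i => unitNormal (c i))
    (T := fun i => edgeNormal (c i) (c (i + 1))) (J := J)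
    (α := fun i => exterior (c i) (c (i + 1))) lorentz lorentz_comm (n := k)
    (fun i => by
      have h := (sin_exterior_pos (hc.rel i)).ne'
      simp only [edgeNormal, smul_smul, mul_inv_cancel₀ h]
      module)
    (fun i => by
      have h := (sin_exterior_pos (hc.rel i)).ne'
      have h2 := Real.sin_sq_add_cos_sq (exterior (c i) (c (i + 1)))
      have h3 : c (i + 1 + k - 1) = c i := by
        rw [show i + 1 + k - 1 = i + k by omega, hc.periodic]
      -- The normal of the same edge seen from the next face is minus the tangent carried along the
      -- arc. The sum of the two edge normals at a face is therefore the jump of the tangent.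
      have h4 : edgeNormal (c (i + 1)) (c i) = Real.sin (exterior (c i) (c (i + 1))) •
          unitNormal (c i) - Real.cos (exterior (c i) (c (i + 1))) •
          edgeNormal (c i) (c (i + 1)) := by
        rw [edgeNormal, edgeNormal, exterior_comm (c (i + 1)) (c i)]
        set s := Real.sin (exterior (c i) (c (i + 1)))
        set t := Real.cos (exterior (c i) (c (i + 1)))
        have h5 : s = s⁻¹ - t * s⁻¹ * t := by
          field_simp
          linarith
        have h6 : s • unitNormal (c i) = (s⁻¹ - t * s⁻¹ * t) • unitNormal (c i) :=
          congrArg (· • unitNormal (c i)) h5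
        rw [h6]
        module
      simp only [hJ, h3, h4]
      module)
    (by simpa using congrArg unitNormal (hc.periodic 0))
    (by
      have h1 : c k = c 0 := by simpa using hc.periodic 0
      have h2 : c (k + 1) = c 1 := by simpa [add_comm] using hc.periodic 1
      simp only [h1, h2, zero_add])
    (fun i => exterior_mem (hc.rel i)) hsum
    (fun i => by
      simp only [hJ, map_add, lorentz_unitNormal_edgeNormal (hc.rel i),
        lorentz_unitNormal_edgeNormal (hprev i), add_zero])
    (fun i j => lorentz_nonpos (hspec i).1 (hspec i).2.1 (hspec j).1 (hspec j).2.1)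
  -- Orthogonal future causal vectors are both lightlike.
  have hnull : ∀ i, i + 1 < k → lorentz (J (i + 1)) (J (i + 1)) = 0 ∧
      lorentz (J (i + 2)) (J (i + 2)) = 0 := fun i hi =>
    ⟨lorentz_self_eq_zero (hspec (i + 1)).1 (hspec (i + 1)).2.1 (hspec (i + 2)).1
      (hspec (i + 2)).2.1 ((lorentz_comm _ _).trans (horth i hi)),
      lorentz_self_eq_zero (hspec (i + 2)).1 (hspec (i + 2)).2.1 (hspec (i + 1)).1
      (hspec (i + 1)).2.1 (horth i hi)⟩
  obtain ⟨v, hv, p, hp, hJ1⟩ := (hspec 1).2.2 (hnull 0 (by omega)).1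
  have hall : ∀ i, i < k → v ∈ (c (i + 1)).verts ∧ ∃ p > 0, J (i + 1) = (p : ℝ) • ((v, 1) : E3 × ℝ) := by
    intro i
    induction i with
    | zero => exact fun _ => ⟨hv, p, hp, hJ1⟩
    | succ i ih =>
      intro hi
      obtain ⟨hvi, q, hq, hJi⟩ := ih (by omega)
      obtain ⟨w, hw, q', hq', hJw⟩ := (hspec (i + 2)).2.2 (hnull i hi).2
      have h1 := horth i hi
      change J (i + 2) = _ at hJw
      rw [hJi, hJw] at h1
      simp only [map_smul, LinearMap.smul_apply, smul_eq_mul, mul_eq_zero, hq.ne', hq'.ne',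
        false_or] at h1
      -- Lightlike vectors in the directions of different ideal vertices have negative product, so
      -- orthogonality carries the vertex to the next face.
      have h2 : w = v := by
        by_contra h
        exact (lorentz_vertex_neg hw.1 hvi.1 h).ne h1
      subst h2
      exact ⟨hw, q', hq', hJw⟩
  refine ⟨v, fun j => ?_⟩
  have hj : j % k < k := Nat.mod_lt _ (by omega)
  rw [← hc.periodic.map_mod_nat]
  rcases Nat.eq_zero_or_pos (j % k) with h | h
  · have h1 := (hall (k - 1) (by omega)).1
    rw [show k - 1 + 1 = 0 + k by omega, hc.periodic] at h1
    rwa [h]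
  · have h1 := (hall (j % k - 1) (by omega)).1
    rwa [show j % k - 1 + 1 = j % k by omega] at h1

end InfiniteIdealPolyhedron

/-! ### Measurability of weighted cycle counts in the local topology. -/

theorem IsCycleSeq.map {V W : Type*} {R : V → V → Prop} {S : W → W → Prop} {k : ℕ} {c : ℕ → V}
    (hc : IsCycleSeq R k c) {d : ℕ → W} (hd : ∀ i j, d i = d j ↔ c i = c j)
    (hS : ∀ i, R (c i) (c (i + 1)) → S (d i) (d (i + 1))) : IsCycleSeq S k d :=
  ⟨hc.three_le, fun i => (hd _ _).2 (hc.periodic i),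
    fun _ hi _ hj hij => hc.injOn hi hj ((hd _ _).1 hij), fun i => hS i (hc.rel i)⟩

namespace BirootedAngledGraph

/-- Cycles of length `k` that start at the mark and pass through the root after `j` steps. -/
@[ext]
structure RootedCycle (k j : ℕ) (X : BirootedAngledGraph) where
  seq : ℕ → X.V
  isCycleSeq : IsCycleSeq X.graph.Adj k seq
  start : seq 0 = X.mark
  pass : seq j = X.root

/-- The angles at the edges along a cycle. -/
def angles {k j : ℕ} {X : BirootedAngledGraph} (c : RootedCycle k j X) (i : Fin k) : ℝ :=
  X.angle (c.seq i) (c.seq (i + 1))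

/-- The sum of the weights `K` of the cycles from the mark through the root. -/
noncomputable def cycleSum (k j : ℕ) (K : (Fin k → ℝ) → ℝ≥0∞) (X : BirootedAngledGraph) : ℝ≥0∞ :=
  ∑' c : RootedCycle k j X, K (angles c)

theorem cycleSum_congr {k j : ℕ} {K : (Fin k → ℝ) → ℝ≥0∞} {X Y : BirootedAngledGraph}
    (h : X ≈ Y) : cycleSum k j K X = cycleSum k j K Y := by
  obtain ⟨φ, hφ, hr, hm⟩ := h
  let e : RootedCycle k j X ≃ RootedCycle k j Y :=
    { toFun := fun c => ⟨fun i => φ (c.seq i), c.isCycleSeq.map (fun _ _ => φ.injective.eq_iff)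
        fun _ => φ.map_adj_iff.2, by rw [c.start, hm], by rw [c.pass, hr]⟩
      invFun := fun c => ⟨fun i => φ.symm (c.seq i), c.isCycleSeq.map (fun _ _ => φ.symm.injective.eq_iff)
        fun _ => φ.symm.map_adj_iff.2, by rw [c.start, ← hm]; simp, by rw [c.pass, ← hr]; simp⟩
      left_inv := fun c => RootedCycle.ext (funext fun i => by simp)
      right_inv := fun c => RootedCycle.ext (funext fun i => by simp) }
  unfold cycleSum
  rw [← e.tsum_eq]
  refine tsum_congr fun c => congrArg K (funext fun i => ?_)
  exact (hφ _ _ (c.isCycleSeq.rel i)).symm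

/-- Every vertex of the cycle is reached from the root by going forward along it. The multiple `j *
k` of the period only keeps the natural subtraction of `j` harmless. -/
theorem mem_ball_of_rootedCycle {k j : ℕ} {X : BirootedAngledGraph} (c : RootedCycle k j X)
    {r : ℕ} (hr : k + j * k ≤ r) (i : ℕ) : c.seq i ∈ X.ball X.root r := by
  have hk := c.isCycleSeq.three_le
  have hdist : ∀ t, X.graph.dist (c.seq j) (c.seq (j + t)) ≤ t := fun t => by
    induction t with
    | zero => simp
    | succ t ih =>
      have h1 := X.connected.dist_triangle (u := c.seq j) (v := c.seq (j + t)) (w := c.seq (j + (t + 1)))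
      have h2 : X.graph.dist (c.seq (j + t)) (c.seq (j + (t + 1))) = 1 :=
        SimpleGraph.dist_eq_one_iff_adj.2 (c.isCycleSeq.rel (j + t))
      omega
  have h1 : i % k < k := Nat.mod_lt _ (by omega)
  have h2 : j ≤ j * k := Nat.le_mul_of_pos_right j (by omega)
  have h3 : c.seq i = c.seq (j + (i % k + j * k - j)) := by
    rw [show j + (i % k + j * k - j) = i % k + j * k by omega, ← c.isCycleSeq.periodic.map_mod_nat,
      ← c.isCycleSeq.periodic.map_mod_nat (i % k + j * k)]
    simp
  rw [h3]
  have h4 : X.graph.dist X.root (c.seq (j + (i % k + j * k - j))) ≤ i % k + j * k - j := by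
    have := hdist (i % k + j * k - j)
    rwa [c.pass] at this
  exact h4.trans (by omega)

/-- Starting from step `j`, the cycle is a walk from the root in a locally finite graph, and one
period determines it. -/
theorem finite_rootedCycle (k j : ℕ) (X : BirootedAngledGraph) : Finite (RootedCycle k j X) := by
  let D : ℕ → Set X.V := fun t => Nat.rec {X.root} (fun _ s => ⋃ v ∈ s, X.graph.neighborSet v) t
  have hD : ∀ t, (D t).Finite := fun t => by
    induction t with
    | zero => exact Set.finite_singleton _
    | succ t ih => exact ih.biUnion fun v _ => X.finite_neighborSet v
  have hmem : ∀ (c : RootedCycle k j X) (t : ℕ), c.seq (j + t) ∈ D t := fun c t => by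
    induction t with
    | zero => exact c.pass
    | succ t ih => exact Set.mem_biUnion ih (c.isCycleSeq.rel (j + t))
  have hfin : (Set.univ.pi fun t : Fin k => D t).Finite := Set.Finite.pi fun t => hD t
  have := hfin.to_subtype
  refine Finite.of_injective (β := (Set.univ.pi fun t : Fin k => D t))
    (fun c => ⟨fun t => c.seq (j + t), fun t _ => hmem c t⟩) fun c d hcd => ?_
  have hk := c.isCycleSeq.three_le
  refine RootedCycle.ext (funext fun i => ?_)
  have h1 : ∀ t < k, c.seq (j + t) = d.seq (j + t) := fun t ht =>
    congrFun (congrArg Subtype.val hcd) ⟨t, ht⟩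
  have h2 : j ≤ j * k := Nat.le_mul_of_pos_right j (by omega)
  have h3 : (j + (i + j * k - j) % k) % k = i % k := by
    rw [Nat.add_mod_mod, show j + (i + j * k - j) = i + j * k by omega]
    simp
  rw [← c.isCycleSeq.periodic.map_mod_nat i, ← d.isCycleSeq.periodic.map_mod_nat i, ← h3,
    c.isCycleSeq.periodic.map_mod_nat, d.isCycleSeq.periodic.map_mod_nat]
  exact h1 _ (Nat.mod_lt _ (by omega))

/-- An isomorphism of balls maps the cycles through the root inside these balls to each other. -/
def ballEquiv {k j r : ℕ} {X Y : BirootedAngledGraph}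
    (φ : AngledGraph.BallIso X.toAngledGraph Y.toAngledGraph X.root Y.root r)
    (hroot : (φ ⟨X.root, X.self_mem_ball X.root r⟩ : Y.V) = Y.root)
    (hm : X.mark ∈ X.ball X.root r) (hmark : (φ ⟨X.mark, hm⟩ : Y.V) = Y.mark)
    (hr : k + j * k ≤ r) : RootedCycle k j X ≃ RootedCycle k j Y where
  toFun c := ⟨fun i => φ ⟨c.seq i, mem_ball_of_rootedCycle c hr i⟩,
    c.isCycleSeq.map (fun _ _ => by rw [← Subtype.ext_iff, φ.injective.eq_iff, Subtype.mk.injEq])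
      fun _ h => (φ.map_adj_iff (v := ⟨_, _⟩) (w := ⟨_, _⟩)).2 h,
    by simp only [c.start, hmark], by simp only [c.pass, hroot]⟩
  invFun c := ⟨fun i => φ.symm ⟨c.seq i, mem_ball_of_rootedCycle c hr i⟩,
    c.isCycleSeq.map (fun _ _ => by rw [← Subtype.ext_iff, φ.symm.injective.eq_iff, Subtype.mk.injEq])
      fun _ h => (φ.symm.map_adj_iff (v := ⟨_, _⟩) (w := ⟨_, _⟩)).2 h,
    by simp only [c.start, ← hmark]; simp, by simp only [c.pass, ← hroot]; simp⟩
  left_inv c := RootedCycle.ext (funext fun i => by simp)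
  right_inv c := RootedCycle.ext (funext fun i => by simp)

/-- On a neighbourhood given by a large enough ball the cycles are in bijection with those of `X`
and only their angles move, so the sum becomes a continuous function of finitely many angles. -/
theorem continuous_cycleSum (k j : ℕ) {K : (Fin k → ℝ) → ℝ≥0∞} (hK : Continuous K) :
    Continuous (cycleSum k j K) := by
  rw [continuous_def]
  intro U hU
  rw [isOpen_iff_forall_mem_open]
  intro X hX
  have := finite_rootedCycle k j X
  have := Fintype.ofFinite (RootedCycle k j X)
  let g : (RootedCycle k j X → Fin k → ℝ) → ℝ≥0∞ := fun a => ∑ c, K (a c)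
  have hg : Continuous g := continuous_finsetSum _ fun c _ => hK.comp (continuous_apply c)
  have hgX : g angles ∈ U := by
    have : cycleSum k j K X = g angles := tsum_fintype _
    rw [← this]; exact hX
  obtain ⟨ε, hε, hball⟩ := Metric.isOpen_iff.1 (hU.preimage hg) _ hgX
  -- The second entry ensures that `X` belongs to its own neighbourhood even when it has no such
  -- cycle.
  set r := max (k + j * k) (X.graph.dist X.root X.mark) with hrdef
  refine ⟨X.near r ε, ?_, TopologicalSpace.isOpen_generateFrom_of_mem ⟨X, r, ε, rfl⟩, ?_⟩
  · rintro Y ⟨φ, ⟨hroot, hclose⟩, hm, hmark⟩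
    have hr : k + j * k ≤ r := le_max_left _ _
    let e := ballEquiv φ hroot hm hmark hr
    have h1 : cycleSum k j K Y = g fun c => angles (e c) := by
      unfold cycleSum
      rw [← e.tsum_eq, tsum_fintype]
    rw [Set.mem_preimage, h1]
    apply hball
    rw [Metric.mem_ball, dist_pi_lt_iff hε]
    intro c
    rw [dist_pi_lt_iff hε]
    intro i
    rw [dist_comm, Real.dist_eq]
    exact hclose ⟨c.seq i, mem_ball_of_rootedCycle c hr i⟩
      ⟨c.seq (i + 1), mem_ball_of_rootedCycle c hr (i + 1)⟩ (c.isCycleSeq.rel i)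
  · refine ⟨SimpleGraph.Iso.refl, ⟨rfl, fun u v _ => ?_⟩, ?_, rfl⟩
    · simpa using hε
    · exact le_max_right (k + j * k) (X.graph.dist X.root X.mark)

/-- The sum of the weights of the cycles from the mark through the root, on isomorphism classes. -/
noncomputable def classCycleSum (k j : ℕ) (K : (Fin k → ℝ) → ℝ≥0∞) : Class → ℝ≥0∞ :=
  Quotient.lift (cycleSum k j K) fun _ _ h => cycleSum_congr h

theorem continuous_classCycleSum (k j : ℕ) {K : (Fin k → ℝ) → ℝ≥0∞} (hK : Continuous K) :
    Continuous (classCycleSum k j K) :=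
  (continuous_cycleSum k j hK).quotient_lift _

/-- The weight of a cycle with angle sum `s`: its angle number `j`; other cycles have weight `0`. -/
noncomputable def exactWeight {k : ℕ} (s : ℝ) (j : Fin k) (a : Fin k → ℝ) : ℝ≥0∞ :=
  open Classical in if ∑ i, a i = s then ENNReal.ofReal (a j) else 0

theorem measurable_classCycleSum_exactWeight {k : ℕ} (s : ℝ) (j : Fin k) :
    Measurable (classCycleSum k j (exactWeight s j)) := by
  -- Continuous tents around the angle sum `s`, narrowing to the indicator of that sum. For each
  -- cycle the weight is eventually constant in `n`.
  let K : ℕ → (Fin k → ℝ) → ℝ≥0∞ := fun n a =>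
    ENNReal.ofReal (max 0 (1 - n * |∑ i, a i - s|) * a j)
  have hK : ∀ n, Continuous (K n) := fun n => ENNReal.continuous_ofReal.comp (by fun_prop)
  have hBorel : BorelSpace Class := ⟨rfl⟩
  refine measurable_of_tendsto_metrizable
    (fun n => (continuous_classCycleSum k j (hK n)).measurable) (tendsto_pi_nhds.2 fun x => ?_)
  induction x using Quotient.inductionOn with
  | h X =>
    have := finite_rootedCycle k j X
    have := Fintype.ofFinite (RootedCycle k j X)
    have h1 : ∀ K, classCycleSum k j K (Quotient.mk _ X) = ∑ c : RootedCycle k j X, K (angles c) :=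
      fun K => tsum_fintype _
    simp only [h1]
    refine tendsto_finsetSum _ fun c _ => ?_
    by_cases h : ∑ i, angles c i = s
    · have : ∀ n, K n (angles c) = exactWeight s j (angles c) := fun n => by
        simp [K, exactWeight, h]
      simp only [this]
      exact tendsto_const_nhds
    · have hpos : 0 < |∑ i, angles c i - s| := abs_pos.2 (sub_ne_zero.2 h)
      obtain ⟨m, hm⟩ := Archimedean.arch 1 hpos
      refine tendsto_const_nhds.congr' (Filter.eventually_atTop.2 ⟨m, fun n hn => ?_⟩)
      have h2 : 1 - (n : ℝ) * |∑ i, angles c i - s| ≤ 0 := by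
        rw [nsmul_eq_mul] at hm
        have : (m : ℝ) ≤ n := by exact_mod_cast hn
        nlinarith
      simp only [K, exactWeight, h, max_eq_left h2]
      simp

end BirootedAngledGraph

/-! ### The transport, and the mass sent and received in an angled graph. -/

theorem IsCycleSeq.shift {V : Type*} {R : V → V → Prop} {k : ℕ} {c : ℕ → V}
    (hc : IsCycleSeq R k c) (j : ℕ) : IsCycleSeq R k fun i => c (i + j) :=
  ⟨hc.three_le, fun i => by rw [add_right_comm]; exact hc.periodic _, fun a ha b hb hab => by
    have h1 : a + j ≡ b + j [MOD k] := hc.modEq_of_eq hab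
    have h2 : a ≡ b [MOD k] := Nat.ModEq.add_right_cancel' j h1
    rwa [Nat.ModEq, Nat.mod_eq_of_lt ha, Nat.mod_eq_of_lt hb] at h2,
    fun i => by rw [add_right_comm]; exact hc.rel _⟩

theorem Function.Periodic.sum_range_add {k : ℕ} {a : ℕ → ℝ} (ha : Function.Periodic a k) (j : ℕ) :
    ∑ i ∈ Finset.range k, a (i + j) = ∑ i ∈ Finset.range k, a i := by
  induction j with
  | zero => rfl
  | succ j ih =>
    have h1 := Finset.sum_range_succ (fun i => a (i + j)) k
    have h2 := Finset.sum_range_succ' (fun i => a (i + j)) k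
    have h3 : a (k + j) = a (0 + j) := by rw [zero_add, add_comm]; exact ha j
    simp only [add_assoc, add_comm 1] at h1 h2 ⊢
    rw [← ih]
    linarith

namespace AngledGraph

variable (X : AngledGraph)

/-- Cycles of length `k` from `o`. -/
abbrev CycleAt (k : ℕ) (o : X.V) : Type := {c : ℕ → X.V // IsCycleSeq X.graph.Adj k c ∧ c 0 = o}

/-- The sum of the angles along the first `k` edges of `c`. -/
def angleSum (k : ℕ) (c : ℕ → X.V) : ℝ := ∑ i ∈ Finset.range k, X.angle (c i) (c (i + 1))

/-- The angle sum of a cycle around a vertex of degree `k` of a polyhedron. -/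
noncomputable def vertexAngleSum (k : ℕ) : ℝ := ((k : ℝ) - 2) * Real.pi

/-- Transport, for every cycle from the mark with the angle sum of a vertex, that passes through the
root, of the angle between the root and the next vertex of the cycle, divided by twice its
length. -/
noncomputable def transport (Z : BirootedAngledGraph.Class) : ℝ≥0∞ :=
  -- At `k = 0` the factor is `∞`, but the sum over `Fin 0` is 0 and so is the product.
  ∑' k : ℕ, (2 * k : ℝ≥0∞)⁻¹ * ∑ j : Fin k, BirootedAngledGraph.classCycleSum k j
    (BirootedAngledGraph.exactWeight (vertexAngleSum k) j) Z

theorem measurable_transport : Measurable transport :=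
  Measurable.tsum fun _ => (Finset.measurable_fun_sum _ fun j _ =>
    BirootedAngledGraph.measurable_classCycleSum_exactWeight _ j).const_mul _

open Classical in
theorem transport_pair (u v : X.V) : transport (X.pair u v) = ∑' k : ℕ, (2 * k : ℝ≥0∞)⁻¹ *
    ∑ j : Fin k, ∑' c : {c : ℕ → X.V // IsCycleSeq X.graph.Adj k c ∧ c 0 = v ∧ c j = u},
      if X.angleSum k c = vertexAngleSum k then
        ENNReal.ofReal (X.angle (c.1 j) (c.1 (j + 1))) else 0 := by
  unfold transport
  refine tsum_congr fun k => congrArg _ (Finset.sum_congr rfl fun j _ => ?_)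
  let Y : BirootedAngledGraph := { X with root := u, mark := v }
  let e : {c : ℕ → X.V // IsCycleSeq X.graph.Adj k c ∧ c 0 = v ∧ c j = u} ≃
      BirootedAngledGraph.RootedCycle k j Y :=
    ⟨fun c => ⟨c.1, c.2.1, c.2.2.1, c.2.2.2⟩, fun c => ⟨c.seq, c.isCycleSeq, c.start, c.pass⟩,
      fun _ => rfl, fun _ => rfl⟩
  change BirootedAngledGraph.cycleSum k j _ Y = _
  unfold BirootedAngledGraph.cycleSum
  rw [← e.tsum_eq]
  refine tsum_congr fun c => ?_
  have h : ∑ i, BirootedAngledGraph.angles (e c) i = X.angleSum k c.1 :=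
    Fin.sum_univ_eq_sum_range (fun i => X.angle (c.1 i) (c.1 (i + 1))) k
  simp only [BirootedAngledGraph.exactWeight, h]
  rfl

theorem angle_nonneg_of_isCycleSeq {k : ℕ} {c : ℕ → X.V} (hc : IsCycleSeq X.graph.Adj k c) (i : ℕ) :
    0 ≤ X.angle (c i) (c (i + 1)) := (X.angle_mem _ _ (hc.rel i)).1.le

-- Summing over the sender amounts to summing over all positions `j` on a cycle based at `o`, which
-- yields the whole angle sum.
open Classical in
theorem tsum_transport_in (o : X.V) : ∑' v, transport (X.pair v o) = ∑' k : ℕ, (2 * k : ℝ≥0∞)⁻¹ *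
    ∑' c : X.CycleAt k o, if X.angleSum k c = vertexAngleSum k then
      ENNReal.ofReal (vertexAngleSum k) else 0 := by
  simp only [transport_pair]
  rw [ENNReal.tsum_comm]
  refine tsum_congr fun k => ?_
  rw [ENNReal.tsum_mul_left]
  congr 1
  rw [Summable.tsum_finsetSum fun _ _ => ENNReal.summable]
  have h1 : ∀ j : Fin k, (∑' v, ∑' c : {c : ℕ → X.V // IsCycleSeq X.graph.Adj k c ∧ c 0 = o ∧ c j = v},
      if X.angleSum k c = vertexAngleSum k then
        ENNReal.ofReal (X.angle (c.1 j) (c.1 (j + 1))) else 0) = ∑' c : X.CycleAt k o,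
      if X.angleSum k c = vertexAngleSum k then
        ENNReal.ofReal (X.angle (c.1 j) (c.1 (j + 1))) else 0 := fun j => by
    let e : (Σ v, {c : ℕ → X.V // IsCycleSeq X.graph.Adj k c ∧ c 0 = o ∧ c j = v}) ≃ X.CycleAt k o :=
      { toFun := fun c => ⟨c.2.1, c.2.2.1, c.2.2.2.1⟩
        invFun := fun c => ⟨c.1 j, c.1, c.2.1, c.2.2, rfl⟩
        left_inv := by rintro ⟨v, c, h1, h2, rfl⟩; rfl
        right_inv := fun c => rfl }
    rw [← e.tsum_eq]
    exact (ENNReal.tsum_sigma _).symm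
  simp only [h1]
  rw [← Summable.tsum_finsetSum fun _ _ => ENNReal.summable]
  refine tsum_congr fun c => ?_
  split_ifs with h
  · rw [← ENNReal.ofReal_sum_of_nonneg (f := fun j : Fin k => X.angle (c.1 j) (c.1 (j + 1)))
      fun j _ => X.angle_nonneg_of_isCycleSeq c.2.1 j, ← h,
      Fin.sum_univ_eq_sum_range (fun i => X.angle (c.1 i) (c.1 (i + 1))) k]
    rfl
  · simp

theorem angleSum_shift {k : ℕ} {c : ℕ → X.V} (hc : IsCycleSeq X.graph.Adj k c) (j : ℕ) :
    X.angleSum k (fun i => c (i + j)) = X.angleSum k c := by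
  have h : Function.Periodic (fun i => X.angle (c i) (c (i + 1))) k := fun i => by
    simp only [add_right_comm i k 1, hc.periodic i, hc.periodic (i + 1)]
  rw [angleSum, angleSum, ← h.sum_range_add j]
  refine Finset.sum_congr rfl fun i _ => ?_
  rw [add_right_comm]

-- Rotating each cycle so that it starts at `o` makes the term independent of the position `j`; this
-- produces the factor `k`.
open Classical in
theorem tsum_transport_out (o : X.V) : ∑' v, transport (X.pair o v) = ∑' k : ℕ, (2 * k : ℝ≥0∞)⁻¹ *
    ∑' c : X.CycleAt k o, if X.angleSum k c = vertexAngleSum k then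
      k * ENNReal.ofReal (X.angle (c.1 0) (c.1 1)) else 0 := by
  simp only [transport_pair]
  rw [ENNReal.tsum_comm]
  refine tsum_congr fun k => ?_
  rw [ENNReal.tsum_mul_left]
  congr 1
  rw [Summable.tsum_finsetSum fun _ _ => ENNReal.summable]
  have h1 : ∀ j : Fin k, (∑' v, ∑' c : {c : ℕ → X.V // IsCycleSeq X.graph.Adj k c ∧ c 0 = v ∧ c j = o},
      if X.angleSum k c = vertexAngleSum k then
        ENNReal.ofReal (X.angle (c.1 j) (c.1 (j + 1))) else 0) = ∑' c : X.CycleAt k o,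
      if X.angleSum k c = vertexAngleSum k then
        ENNReal.ofReal (X.angle (c.1 0) (c.1 1)) else 0 := fun j => by
    have hj := j.2
    let e : (Σ v, {c : ℕ → X.V // IsCycleSeq X.graph.Adj k c ∧ c 0 = v ∧ c j = o}) ≃ X.CycleAt k o :=
      { toFun := fun c => ⟨fun i => c.2.1 (i + j), c.2.2.1.shift j, by
          simp only [zero_add]; exact c.2.2.2.2⟩
        invFun := fun c => ⟨c.1 (k - j), fun i => c.1 (i + (k - j)), c.2.1.shift _, by
          simp only [zero_add], by
          simp only [show (j : ℕ) + (k - j) = 0 + k by omega, c.2.1.periodic 0, c.2.2]⟩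
        left_inv := by
          rintro ⟨v, c, h1, rfl, h3⟩
          have h4 : (fun i => c (i + (k - j) + j)) = c := funext fun i => by
            rw [show i + (k - j) + j = i + k by omega, h1.periodic]
          refine Sigma.subtype_ext ?_ h4
          simp only [show k - (j : ℕ) + j = 0 + k by omega, h1.periodic 0]
        right_inv := fun c => by
          refine Subtype.ext (funext fun i => ?_)
          simp only [show i + (j : ℕ) + (k - j) = i + k by omega, c.2.1.periodic i] }
    rw [← e.tsum_eq]
    refine (ENNReal.tsum_sigma _).symm.trans ?_
    refine tsum_congr fun c => ?_
    simp only [e, Equiv.coe_fn_mk, X.angleSum_shift c.2.2.1, zero_add, add_comm 1]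
  simp only [h1]
  rw [Finset.sum_const, Finset.card_fin, nsmul_eq_mul, ← ENNReal.tsum_mul_left]
  refine tsum_congr fun c => ?_
  split_ifs <;> simp

-- Combines length and cycle in one index set, to which the bijection with the ends of edges can be
-- applied.
open Classical in
theorem tsum_cycleAt (o : X.V) (a : ℕ → ℝ≥0∞) (h : ℕ → (ℕ → X.V) → ℝ≥0∞) :
    ∑' k : ℕ, a k * ∑' c : X.CycleAt k o, (if X.angleSum k c = vertexAngleSum k then h k c else 0) =
    ∑' z : {z : ℕ × (ℕ → X.V) | IsCycleSeq X.graph.Adj z.1 z.2 ∧ z.2 0 = o ∧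
      X.angleSum z.1 z.2 = vertexAngleSum z.1}, a z.1.1 * h z.1.1 z.1.2 := by
  rw [tsum_subtype (f := fun z : ℕ × (ℕ → X.V) => a z.1 * h z.1 z.2), ENNReal.tsum_prod']
  refine tsum_congr fun k => ?_
  have h1 := tsum_subtype {c : ℕ → X.V | IsCycleSeq X.graph.Adj k c ∧ c 0 = o}
    fun c => if X.angleSum k c = vertexAngleSum k then h k c else 0
  rw [show (∑' c : X.CycleAt k o, if X.angleSum k c = vertexAngleSum k then h k c else 0) = _ from h1,
    ← ENNReal.tsum_mul_left]
  refine tsum_congr fun c => ?_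
  simp only [Set.indicator, Set.mem_ofPred_eq]
  by_cases h2 : IsCycleSeq X.graph.Adj k c <;> by_cases h3 : c 0 = o <;>
    by_cases h4 : X.angleSum k c = vertexAngleSum k <;> simp [h2, h3, h4]

end AngledGraph

theorem tsum_ofReal_eq_ofReal_finsum {α : Type*} {s : Set α} (hs : s.Finite) {h : α → ℝ}
    (hh : ∀ x ∈ s, 0 ≤ h x) : ∑' x : s, ENNReal.ofReal (h x) = ENNReal.ofReal (∑ᶠ x ∈ s, h x) := by
  have := hs.fintype
  rw [tsum_fintype, finsum_mem_eq_toFinset_sum, ENNReal.ofReal_sum_of_nonneg (by simpa using hh)]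
  exact (Finset.sum_subtype s.toFinset (fun x => Set.mem_toFinset) fun x => ENNReal.ofReal (h x)).symm

/-! ### Evaluation of the transport on a polyhedron. -/

namespace InfiniteIdealPolyhedron

variable {P : InfiniteIdealPolyhedron} {f g : P.Face} {v : E3}

open AngledGraph

/-- The pairs of a neighbour of `f` and an ideal vertex of their common edge. -/
def edgeEnds (f : P.Face) : Set (P.Face × E3) :=
  {q | (IdealFace.dualGraph P.vertices).Adj f q.1 ∧ q.2 ∈ f.verts ∩ q.1.verts}

/-- The cycles of faces from `f` with the angle sum of a vertex. -/
def vertexCycles (f : P.Face) : Set (ℕ × (ℕ → P.Face)) :=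
  {z | IsCycleSeq P.dual.graph.Adj z.1 z.2 ∧ z.2 0 = f ∧ P.dual.angleSum z.1 z.2 = vertexAngleSum z.1}

theorem angleSum_eq_iff (k : ℕ) (c : ℕ → P.Face) : P.dual.angleSum k c = vertexAngleSum k ↔
    ∑ i ∈ Finset.range k, exterior (c i) (c (i + 1)) = 2 * Real.pi := by
  have h : ∑ i ∈ Finset.range k, exterior (c i) (c (i + 1)) = k * Real.pi - P.dual.angleSum k c := by
    simp only [exterior, Finset.sum_sub_distrib, Finset.sum_const, Finset.card_range, nsmul_eq_mul]
    rfl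
  rw [h, vertexAngleSum]
  constructor <;> intro h1 <;> linarith

/-- The cycles of faces with the angle sum of a vertex are the vertex cycles, which are determined
by their first edge and one of its ends. -/
theorem exists_equiv_vertexCycles (f : P.Face) : ∃ e : edgeEnds f ≃ vertexCycles f,
    ∀ q, (e q).1.1 = P.vertexDegree q.1.2 ∧ (e q).1.2 0 = f ∧ (e q).1.2 1 = q.1.1 := by
  choose c hc hv h0 h1 hsum huniq using fun q : edgeEnds f =>
    existsUnique_cycleSeq_at q.2.1 q.2.2.1 q.2.2.2
  let F : edgeEnds f → vertexCycles f := fun q =>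
    ⟨(P.vertexDegree q.1.2, c q), hc q, h0 q, (angleSum_eq_iff _ _).2 (hsum q)⟩
  have hF : Function.Bijective F := by
    constructor
    · intro q q' hq
      have e1 : c q = c q' := congrArg (fun z => z.1.2) hq
      have e2 : q.1.1 = q'.1.1 := by rw [← h1, ← h1, e1]
      refine Subtype.ext (Prod.ext e2 ?_)
      by_contra hne
      -- If one cycle ran around two different ideal vertices, three consecutive faces would share
      -- both of them.
      have e3 : c q 0 = c q 2 := eq_of_common_edge ((hc q).rel 0).ne.symm ((hc q).rel 1).ne hne
        (hv q' 1 |> (e1 ▸ ·)) (hv q' 0 |> (e1 ▸ ·)) (hv q' 2 |> (e1 ▸ ·)) (hv q 1) (hv q 0) (hv q 2)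
      have e4 := (hc q).modEq_of_eq e3
      have e5 := (hc q).three_le
      have := Nat.le_of_dvd (by norm_num) ((Nat.modEq_zero_iff_dvd).1 e4.symm)
      omega
    · rintro ⟨⟨k, d⟩, hd, hd0, hs⟩
      -- The only place where the angle sum is used to recognize a vertex; the uniqueness of the
      -- cycle around `v` does the rest.
      obtain ⟨v, hv'⟩ := exists_common_vertex hd ((angleSum_eq_iff _ _).1 hs)
      have hd0 : d 0 = f := hd0
      let q : edgeEnds f := ⟨(d 1, v), by rw [← hd0]; exact hd.rel 0, by rw [← hd0]; exact hv' 0, hv' 1⟩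
      obtain ⟨hk, hdc⟩ := huniq q k d hd hv' hd0 rfl
      exact ⟨q, Subtype.ext (Prod.ext hk.symm hdc.symm)⟩
  exact ⟨Equiv.ofBijective F hF, fun q => ⟨rfl, h0 q, h1 q⟩⟩

theorem three_le_vertexDegree (hv : v ∈ f.verts) : 3 ≤ P.vertexDegree v := by
  obtain ⟨g, hg⟩ : {g | (IdealFace.dualGraph P.vertices).Adj f g ∧ v ∈ g.verts}.Nonempty := by
    rw [← Set.encard_ne_zero, encard_adj_at hv]; norm_num
  obtain ⟨c, hc, -⟩ := existsUnique_cycleSeq_at hg.1 hv hg.2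
  exact hc.three_le

theorem tsum_transport_out_eq (f : P.Face) :
    ∑' g : P.Face, transport (P.dual.pair f g) = ENNReal.ofReal (P.character f) := by
  obtain ⟨e, he⟩ := exists_equiv_vertexCycles f
  refine (P.dual.tsum_transport_out f).trans ((P.dual.tsum_cycleAt f _
    fun k c => k * ENNReal.ofReal (P.dual.angle (c 0) (c 1))).trans ?_)
  refine (e.tsum_eq (fun z : vertexCycles f => (2 * (z.1.1 : ℝ≥0∞))⁻¹ *
    (z.1.1 * ENNReal.ofReal (P.dual.angle (z.1.2 0) (z.1.2 1))))).symm.trans ?_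
  have h1 : ∀ q : edgeEnds f, (2 * ((e q).1.1 : ℝ≥0∞))⁻¹ *
      ((e q).1.1 * ENNReal.ofReal (P.dual.angle ((e q).1.2 0) ((e q).1.2 1))) =
      2⁻¹ * ENNReal.ofReal (f.dihedral q.1.1) := fun q => by
    obtain ⟨e1, e2, e3⟩ := he q
    have h2 : (P.vertexDegree q.1.2 : ℝ≥0∞) ≠ 0 := by
      have := three_le_vertexDegree q.2.2.1
      simp only [ne_eq, Nat.cast_eq_zero]; omega
    have h3 : ∀ k x : ℝ≥0∞, k ≠ 0 → k ≠ ∞ → (2 * k)⁻¹ * (k * x) = 2⁻¹ * x := fun k x hk hk' => by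
      rw [ENNReal.mul_inv (by simp) (by simp), mul_assoc, ← mul_assoc k⁻¹,
        ENNReal.inv_mul_cancel hk hk', one_mul]
    rw [e1, e2, e3, h3 _ _ h2 (by simp)]
    rfl
  rw [tsum_congr h1]
  -- Grouping by the adjacent face: each edge has two ends, which cancels the factor `2⁻¹`.
  let s : (Σ g : (IdealFace.dualGraph P.vertices).neighborSet f,
      {v | v ∈ f.verts ∩ g.1.verts}) ≃ edgeEnds f :=
    ⟨fun q => ⟨(q.1.1, q.2.1), q.1.2, q.2.2⟩, fun q => ⟨⟨q.1.1, q.2.1⟩, q.1.2, q.2.2⟩,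
      fun _ => rfl, fun _ => rfl⟩
  rw [← s.tsum_eq, ENNReal.tsum_sigma', character,
    ← tsum_ofReal_eq_ofReal_finsum (P.finite_neighborSet f)
      fun g hg => (P.dihedral_mem f g hg).1.le]
  refine tsum_congr fun g => ?_
  change ∑' _ : {v | v ∈ f.verts ∩ g.1.verts}, 2⁻¹ * ENNReal.ofReal (f.dihedral g.1) = _
  have h3 : {v | v ∈ f.verts ∩ g.1.verts}.encard = 2 := g.2.2
  rw [ENNReal.tsum_set_const, h3, ← mul_assoc]
  simp [ENNReal.mul_inv_cancel]

theorem tsum_transport_in_eq (f : P.Face) :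
    ∑' g : P.Face, transport (P.dual.pair g f) = ENNReal.ofReal (P.combinatorialAngle f) := by
  obtain ⟨e, he⟩ := exists_equiv_vertexCycles f
  refine (P.dual.tsum_transport_in f).trans ((P.dual.tsum_cycleAt f _
    fun k c => ENNReal.ofReal (vertexAngleSum k)).trans ?_)
  refine (e.tsum_eq (fun z : vertexCycles f => (2 * (z.1.1 : ℝ≥0∞))⁻¹ *
    ENNReal.ofReal (vertexAngleSum z.1.1))).symm.trans ?_
  have h1 : ∀ q : edgeEnds f, (2 * ((e q).1.1 : ℝ≥0∞))⁻¹ * ENNReal.ofReal (vertexAngleSum (e q).1.1) =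
      2⁻¹ * ENNReal.ofReal (((P.vertexDegree q.1.2 : ℝ) - 2) * Real.pi / P.vertexDegree q.1.2) :=
    fun q => by
      have h2 := three_le_vertexDegree q.2.2.1
      rw [(he q).1, vertexAngleSum, ENNReal.mul_inv (by simp) (by simp),
        ENNReal.ofReal_div_of_pos (by exact_mod_cast (by omega : 0 < P.vertexDegree q.1.2)),
        ENNReal.ofReal_natCast, ENNReal.div_eq_inv_mul, mul_assoc]
  rw [tsum_congr h1]
  -- Grouping by the ideal vertex: `f` has two neighbours there, one for each orientation, which
  -- cancels the factor `2⁻¹`.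
  let s : (Σ v : f.verts, {g | (IdealFace.dualGraph P.vertices).Adj f g ∧ v.1 ∈ g.verts}) ≃
      edgeEnds f :=
    ⟨fun q => ⟨(q.2.1, q.1.1), q.2.2.1, q.1.2, q.2.2.2⟩,
      fun q => ⟨⟨q.1.2, q.2.2.1⟩, q.1.1, q.2.1, q.2.2.2⟩, fun _ => rfl, fun _ => rfl⟩
  rw [← s.tsum_eq, ENNReal.tsum_sigma', combinatorialAngle,
    ← tsum_ofReal_eq_ofReal_finsum (P.finite_verts f) fun v hv => ?_]
  · refine tsum_congr fun v => ?_
    change ∑' _ : {g | (IdealFace.dualGraph P.vertices).Adj f g ∧ v.1 ∈ g.verts},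
      2⁻¹ * ENNReal.ofReal (((P.vertexDegree v.1 : ℝ) - 2) * Real.pi / P.vertexDegree v.1) = _
    rw [ENNReal.tsum_set_const, encard_adj_at v.2, ← mul_assoc]
    simp [ENNReal.mul_inv_cancel]
  · have h3 : (3 : ℝ) ≤ P.vertexDegree v := by exact_mod_cast three_le_vertexDegree hv
    exact div_nonneg (mul_nonneg (by linarith) Real.pi_pos.le) (by linarith)

theorem ofReal_character_le (f : P.Face) :
    ENNReal.ofReal (P.character f) ≤ ENNReal.ofReal Real.pi * P.faceDegree f := by
  rw [character, ← tsum_ofReal_eq_ofReal_finsum (P.finite_neighborSet f)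
      fun g hg => (P.dihedral_mem f g hg).1.le]
  calc _ ≤ ∑' _ : (IdealFace.dualGraph P.vertices).neighborSet f, ENNReal.ofReal Real.pi :=
        ENNReal.tsum_le_tsum fun g => ENNReal.ofReal_le_ofReal (P.dihedral_mem f g g.2).2.le
    _ = _ := by
        rw [ENNReal.tsum_set_const, mul_comm, faceDegree, ← (P.finite_neighborSet f).cast_ncard_eq]
        rfl

end InfiniteIdealPolyhedron

/-- A random rooted infinite ideal polyhedron `P` with root face `f`, unimodular in the sense that
its dual `1`-skeleton with dihedral angles is a unimodular random rooted angled graph, has equal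
expected character and expected combinatorial angle (in `[0, ∞]`), and both are finite when the
expected degree of the root face is. -/
theorem theorem1p6 {Ω : Type*} [MeasurableSpace Ω] (μ : Measure Ω) [IsProbabilityMeasure μ]
    (P : Ω → InfiniteIdealPolyhedron) (f : (ω : Ω) → (P ω).Face)
    (hP : IsUnimodular μ fun ω => (P ω).rootedDual (f ω)) :
    (∫⁻ ω, ENNReal.ofReal ((P ω).character (f ω)) ∂μ =
      ∫⁻ ω, ENNReal.ofReal ((P ω).combinatorialAngle (f ω)) ∂μ) ∧
    (∫⁻ ω, ((P ω).faceDegree (f ω) : ℝ≥0∞) ∂μ < ∞ →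
      ∫⁻ ω, ENNReal.ofReal ((P ω).character (f ω)) ∂μ < ∞ ∧
      ∫⁻ ω, ENNReal.ofReal ((P ω).combinatorialAngle (f ω)) ∂μ < ∞) := by
  have heq : ∫⁻ ω, ENNReal.ofReal ((P ω).character (f ω)) ∂μ =
      ∫⁻ ω, ENNReal.ofReal ((P ω).combinatorialAngle (f ω)) ∂μ := by
    have h := hP.mass_transport AngledGraph.transport AngledGraph.measurable_transport
    simp only [← InfiniteIdealPolyhedron.tsum_transport_out_eq,
      ← InfiniteIdealPolyhedron.tsum_transport_in_eq]
    exact h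
  refine ⟨heq, fun hdeg => ?_⟩
  rw [← heq, and_self]
  calc _ ≤ ∫⁻ ω, ENNReal.ofReal Real.pi * (P ω).faceDegree (f ω) ∂μ :=
        lintegral_mono fun ω => InfiniteIdealPolyhedron.ofReal_character_le (f ω)
    _ = ENNReal.ofReal Real.pi * ∫⁻ ω, ((P ω).faceDegree (f ω) : ℝ≥0∞) ∂μ :=
        lintegral_const_mul' _ _ ENNReal.ofReal_ne_top
    _ < ∞ := ENNReal.mul_lt_top ENNReal.ofReal_lt_top hdeg
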